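/- All Hilbert spaces are finite dimensional, a state is a positive semidefinite operator of trace one, a channel is a completely positive trace-preserving linear map, and $T_X$ denotes the transpose on system $X$ in a fixed orthonormal basis. For channels $\mathcal N,\mathcal M$ from $C$ to $D$ put $$\|\mathcal N-\mathcal M\|_\diamond=\sup_{\sigma_{RC}}\|\mathcal N(\sigma_{RC})-\mathcal M(\sigma_{RC})\|_1,\qquad F(\mathcal N,\mathcal M)=\inf_{\sigma_{RC}}F(\mathcal N(\sigma_{RC}),\mathcal M(\sigma_{RC})),$$ over all states $\sigma_{RC}$ with $R$ an arbitrary finite-dimensional reference system (on which the channels act trivially), where $\|X\|_1=\operatorname{Tr}\sqrt{X^\dagger X}$ and $F(\omega,\tau)=\|\sqrt\omega\sqrt\tau\|_1^2$. A channel $\mathcal P_{AB\hat A\hat B\to A'B'}$ is C-PPT-P if $T_{B'}\circ\mathcal P\circ T_{B\hat B}$ is completely positive. For a channel $\mathcal N_{AB\to A'B'}$ and a state $\rho_{\hat A\hat B}$ let $$e_{\mathrm{PPT}}(\mathcal N,\rho)=\inf_{\mathcal P}\tfrac12\|\mathcal N-\widetilde{\mathcal N}_{\mathcal P}\|_\diamond,\qquad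 e^F_{\mathrm{PPT}}(\mathcal N,\rho)=\inf_{\mathcal P}\,[1-F(\mathcal N,\widetilde{\mathcal N}_{\mathcal P})],\qquad \widetilde{\mathcal N}_{\mathcal P}(\omega_{AB})=\mathcal P(\omega_{AB}\otimes\rho_{\hat A\hat B}),$$ the infima being over all C-PPT-P channels $\mathcal P_{AB\hat A\hat B\to A'B'}$. Let $\mathcal S^d(\omega)=F\omega F^\dagger$ with $F=\sum_{i,j}|i\rangle\langle j|\otimes|j\rangle\langle i|$ be the swap channel on two $d$-dimensional systems, $d\ge1$, with Choi operator $\Gamma^{\mathcal S^d}_{ABA'B'}$. **Proposition.** For every state $\rho_{\hat A\hat B}$ on finite-dimensional systems $\hat A,\hat B$, $$e^F_{\mathrm{PPT}}(\mathcal S^d,\rho)=e_{\mathrm{PPT}}(\mathcal S^d,\rho),$$ and this common value equals $1-[\sup\lambda]^2$, the supremum being over real $\lambda\ge0$, operators $P_{AB\hat A\hat BA'B'}\ge0$ and arbitrary operators $Q_{ABA'B'}$ subject to $\lambda I_{AB}\le\operatorname{Re}[\operatorname{Tr}_{A'B'}Q]$ (where $\operatorname{Re}[X]=(X+X^\dagger)/2$),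 $T_{B\hat BB'}(P)\ge0$, $\operatorname{Tr}_{A'B'}[P]=I_{AB\hat A\hat B}$ and $$\begin{bmatrix}\Gamma^{\mathcal S^d}&Q^\dagger\\Q&\operatorname{Tr}_{\hat A\hat B}[T_{\hat A\hat B}(\rho_{\hat A\hat B})P]\end{bmatrix}\ge0.$$ If moreover $d\ge2$, it also equals the reduced semidefinite program $$1-\sup_{K,L,M,N\ge0}\operatorname{Tr}[\rho_{\hat A\hat B}K],$$ over operators $K,L,M,N$ on $\hat A\hat B$ subject to $K+L+M+N=I$ and $$T_{\hat B}\Big(K+\tfrac{L}{d+1}+\tfrac{M}{d+1}+\tfrac{N}{(d+1)^2}\Big)\ge0,\qquad \tfrac1{d-1}T_{\hat B}\Big(L+\tfrac{N}{d+1}\Big)\ge T_{\hat B}\Big(K+\tfrac{M}{d+1}\Big),$$ $$\tfrac1{d-1}T_{\hat B}\Big(M+\tfrac{N}{d+1}\Big)\ge T_{\hat B}\Big(K+\tfrac{L}{d+1}\Big),\qquad T_{\hat B}\Big(K+\tfrac{N}{(d-1)^2}\Big)\ge\tfrac1{d-1}T_{\hat B}(L+M).$$ -/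

import Mathlib

open scoped Matrix MatrixOrder ComplexOrder Kronecker

noncomputable section

namespace BQT

/-- Linear maps from operators on `ℂ^m` to operators on `ℂ^n`. -/
abbrev Superop (m n : Type*) := Matrix m m ℂ →ₗ[ℂ] Matrix n n ℂ

section Basic

variable {m n k : Type*}

/-- Quantum states: positive semidefinite operators of trace one. -/
def IsState [Fintype m] (ρ : Matrix m m ℂ) : Prop := ρ.PosSemidef ∧ ρ.trace = 1

/-- The action `(id_R ⊗ N)(X)` of `N` on the second tensor factor, where `R = ℂ^k`. -/
def ampliate (N : Superop m n) (X : Matrix (k × m) (k × m) ℂ) : Matrix (k × n) (k × n) ℂ :=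
  Matrix.of fun p q => N (Matrix.of fun i j => X (p.1, i) (q.1, j)) p.2 q.2

/-- Complete positivity: `id_R ⊗ N` preserves positive semidefiniteness for every
finite-dimensional reference system `R`. -/
def IsCP (N : Superop m n) : Prop :=
  ∀ (r : ℕ) (X : Matrix (Fin r × m) (Fin r × m) ℂ), X.PosSemidef → (ampliate N X).PosSemidef

/-- Quantum channels: completely positive trace-preserving linear maps. -/
def IsChannel [Fintype m] [Fintype n] (N : Superop m n) : Prop :=
  IsCP N ∧ ∀ X : Matrix m m ℂ, (N X).trace = X.trace

/-- The trace norm `‖X‖₁ = Tr |X|`, where `|X| = √(X† X)`. -/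
def traceNorm [Fintype n] [DecidableEq n] (X : Matrix n n ℂ) : ℝ :=
  (CFC.sqrt (Xᴴ * X)).trace.re

/-- The fidelity `F(ω, τ) = ‖√ω √τ‖₁²`. -/
def fidelity [Fintype n] [DecidableEq n] (ω τ : Matrix n n ℂ) : ℝ :=
  traceNorm (CFC.sqrt ω * CFC.sqrt τ) ^ 2

/-- The diamond distance of two channels: the supremum of the trace distance of the outputs over
all input states shared with a finite-dimensional reference system. -/
def diamondDist [Fintype m] [Fintype n] [DecidableEq n] (N M : Superop m n) : ℝ :=
  sSup {x : ℝ | ∃ (r : ℕ) (σ : Matrix (Fin r × m) (Fin r × m) ℂ),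
    IsState σ ∧ x = traceNorm (ampliate N σ - ampliate M σ)}

/-- The channel fidelity: the infimum of the fidelity of the outputs over all input states shared
with a finite-dimensional reference system. -/
def channelFidelity [Fintype m] [Fintype n] [DecidableEq n] (N M : Superop m n) : ℝ :=
  sInf {x : ℝ | ∃ (r : ℕ) (σ : Matrix (Fin r × m) (Fin r × m) ℂ),
    IsState σ ∧ x = fidelity (ampliate N σ) (ampliate M σ)}

/-- The unnormalized maximally entangled operator `|Γ⟩⟨Γ|`, with `|Γ⟩ = ∑ i, |i⟩|i⟩`. -/
def maxEnt (m : Type*) [DecidableEq m] : Matrix (m × m) (m × m) ℂ :=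
  Matrix.of fun p q => if p.1 = p.2 ∧ q.1 = q.2 then 1 else 0

/-- The Choi operator `(id_R ⊗ N)(|Γ⟩⟨Γ|)`, with `R` isomorphic to the input system. -/
def choi [DecidableEq m] (N : Superop m n) : Matrix (m × n) (m × n) ℂ :=
  ampliate N (maxEnt m)

/-- The partial trace over the second tensor factor. -/
def traceSnd [Fintype n] (X : Matrix (m × n) (m × n) ℂ) : Matrix m m ℂ :=
  Matrix.of fun i j => ∑ k, X (i, k) (j, k)

/-- The partial transpose on the second tensor factor, `T_B` on the bipartite system `AB`. -/
def transposeSnd : Superop (m × n) (m × n) where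
  toFun X := Matrix.of fun p q => X (p.1, q.2) (q.1, p.2)
  map_add' _ _ := rfl
  map_smul' _ _ := rfl

/-- The Hermitian part `Re[X] = (X + X†) / 2`. -/
def hermPart (X : Matrix m m ℂ) : Matrix m m ℂ := (1 / 2 : ℝ) • (X + Xᴴ)

end Basic

section Simulation

/- Alice holds the input `A`, the output `A'` (here `A₂`) and the share `Â` (here `E`) of the
resource; Bob holds `B`, `B'` (here `B₂`) and `B̂` (here `G`). -/
variable {A B A₂ B₂ E G : Type*}

/-- The transpose `T_{B B̂}` on the systems of Bob among `A B Â B̂`. -/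
def transposeBob : Superop ((A × B) × (E × G)) ((A × B) × (E × G)) where
  toFun X := Matrix.of fun p q =>
    X ((p.1.1, q.1.2), (p.2.1, q.2.2)) ((q.1.1, p.1.2), (q.2.1, p.2.2))
  map_add' _ _ := rfl
  map_smul' _ _ := rfl

/-- The transpose `T_{B B̂ B'}` on the systems of Bob among `A B Â B̂ A' B'`. -/
def transposeBobChoi (X : Matrix (((A × B) × (E × G)) × (A₂ × B₂))
      (((A × B) × (E × G)) × (A₂ × B₂)) ℂ) :
    Matrix (((A × B) × (E × G)) × (A₂ × B₂)) (((A × B) × (E × G)) × (A₂ × B₂)) ℂ :=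
  Matrix.of fun p q =>
    X (((p.1.1.1, q.1.1.2), (p.1.2.1, q.1.2.2)), (p.2.1, q.2.2))
      (((q.1.1.1, p.1.1.2), (q.1.2.1, p.1.2.2)), (q.2.1, p.2.2))

/-- The simulation `ω ↦ P (ω ⊗ ρ)` obtained from the resource state `ρ` on `Â B̂`. -/
def simulate (P : Superop ((A × B) × (E × G)) (A₂ × B₂)) (ρ : Matrix (E × G) (E × G) ℂ) :
    Superop (A × B) (A₂ × B₂) where
  toFun ω := P (ω ⊗ₖ ρ)
  map_add' X Y := by rw [Matrix.add_kronecker, map_add]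
  map_smul' c X := by rw [Matrix.smul_kronecker, map_smul]; rfl

variable [Fintype A] [Fintype B] [Fintype A₂] [Fintype B₂] [Fintype E] [Fintype G]

/-- C-PPT-P channels `P` from `A B Â B̂` to `A' B'`: quantum channels such that
`T_{B'} ∘ P ∘ T_{B B̂}` is completely positive. -/
def IsCPPTP (P : Superop ((A × B) × (E × G)) (A₂ × B₂)) : Prop :=
  IsChannel P ∧ IsCP (transposeSnd ∘ₗ P ∘ₗ transposeBob)

/-- The C-PPT-P simulation error of `N` with resource `ρ` in normalized diamond distance. -/
def errPPT [DecidableEq A₂] [DecidableEq B₂] (N : Superop (A × B) (A₂ × B₂))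
    (ρ : Matrix (E × G) (E × G) ℂ) : ℝ :=
  sInf {x : ℝ | ∃ P : Superop ((A × B) × (E × G)) (A₂ × B₂),
    IsCPPTP P ∧ x = 1 / 2 * diamondDist N (simulate P ρ)}

/-- The C-PPT-P simulation error of `N` with resource `ρ` in channel infidelity. -/
def errPPTInfid [DecidableEq A₂] [DecidableEq B₂] (N : Superop (A × B) (A₂ × B₂))
    (ρ : Matrix (E × G) (E × G) ℂ) : ℝ :=
  sInf {x : ℝ | ∃ P : Superop ((A × B) × (E × G)) (A₂ × B₂),
    IsCPPTP P ∧ x = 1 - channelFidelity N (simulate P ρ)}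

/-- `Tr_{Â B̂}[T_{Â B̂}(ρ) P]`, an operator on `A B A' B'`. -/
def contractResource (ρ : Matrix (E × G) (E × G) ℂ)
    (P : Matrix (((A × B) × (E × G)) × (A₂ × B₂)) (((A × B) × (E × G)) × (A₂ × B₂)) ℂ) :
    Matrix ((A × B) × (A₂ × B₂)) ((A × B) × (A₂ × B₂)) ℂ :=
  Matrix.of fun p q => ∑ h, ∑ l, ρᵀ h l * P ((p.1, l), p.2) ((q.1, h), q.2)

/-- The semidefinite program for the C-PPT-P simulation error in channel infidelity:
`1 - (sup λ)²` over `λ ≥ 0`, `P ≥ 0` on `A B Â B̂ A' B'` and arbitrary `Q` on `A B A' B'`, subject to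
`λ I ≤ Re[Tr_{A' B'} Q]`, `T_{B B̂ B'}(P) ≥ 0`, `Tr_{A' B'} P = I` and positivity of the block
matrix with blocks `Γ^N`, `Q†`, `Q`, `Tr_{Â B̂}[T_{Â B̂}(ρ) P]`. -/
def infidSDP [DecidableEq A] [DecidableEq B] [DecidableEq E] [DecidableEq G]
    (N : Superop (A × B) (A₂ × B₂)) (ρ : Matrix (E × G) (E × G) ℂ) : ℝ :=
  1 - sSup {l : ℝ | 0 ≤ l ∧
    ∃ (P : Matrix (((A × B) × (E × G)) × (A₂ × B₂)) (((A × B) × (E × G)) × (A₂ × B₂)) ℂ)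
      (Q : Matrix ((A × B) × (A₂ × B₂)) ((A × B) × (A₂ × B₂)) ℂ),
      0 ≤ P ∧
      l • (1 : Matrix (A × B) (A × B) ℂ) ≤ hermPart (traceSnd Q) ∧
      0 ≤ transposeBobChoi P ∧
      traceSnd P = 1 ∧
      0 ≤ Matrix.fromBlocks (choi N) Qᴴ Q (contractResource ρ P)} ^ 2

end Simulation

section Swap

/-- The unitary swap operator `F = ∑ i j, |i⟩⟨j| ⊗ |j⟩⟨i|` on two `d`-dimensional systems. -/
def swapOp (d : ℕ) : Matrix (Fin d × Fin d) (Fin d × Fin d) ℂ :=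
  ∑ i, ∑ j, Matrix.single i j 1 ⊗ₖ Matrix.single j i 1

/-- The swap channel `ω ↦ F ω F†`. -/
def swapChannel (d : ℕ) : Superop (Fin d × Fin d) (Fin d × Fin d) where
  toFun ω := swapOp d * ω * (swapOp d)ᴴ
  map_add' X Y := by rw [Matrix.mul_add, Matrix.add_mul]
  map_smul' c X := by simp

variable {E G : Type*} [Fintype E] [Fintype G] [DecidableEq E] [DecidableEq G]

/-- The constraints of the reduced semidefinite program for the swap channel. -/
def SwapFeasible (d : ℕ) (K L M N : Matrix (E × G) (E × G) ℂ) : Prop :=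
  0 ≤ K ∧ 0 ≤ L ∧ 0 ≤ M ∧ 0 ≤ N ∧
  0 ≤ transposeSnd (K + (1 / (d + 1) : ℝ) • L + (1 / (d + 1) : ℝ) • M +
    (1 / (d + 1) ^ 2 : ℝ) • N) ∧
  transposeSnd (K + (1 / (d + 1) : ℝ) • M) ≤
    (1 / (d - 1) : ℝ) • transposeSnd (L + (1 / (d + 1) : ℝ) • N) ∧
  transposeSnd (K + (1 / (d + 1) : ℝ) • L) ≤
    (1 / (d - 1) : ℝ) • transposeSnd (M + (1 / (d + 1) : ℝ) • N) ∧
  (1 / (d - 1) : ℝ) • transposeSnd (L + M) ≤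
    transposeSnd (K + (1 / (d - 1) ^ 2 : ℝ) • N) ∧
  K + L + M + N = 1

/-- The reduced semidefinite program `1 - sup Tr[ρ K]` for the swap channel. -/
def swapReducedSDP (d : ℕ) (ρ : Matrix (E × G) (E × G) ℂ) : ℝ :=
  1 - sSup {x : ℝ | ∃ K L M N : Matrix (E × G) (E × G) ℂ,
    SwapFeasible d K L M N ∧ x = (ρ * K).trace.re}

end Swap

end BQT

end

/-! The Choi operator of the swap channel S is rank one, γγ† with ‖γ‖² = d². The quantity that
controls everything is the entanglement fidelity f(M) = ⟨γ, choi M γ⟩ / d⁴ (`swapEntFid`). Feeding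
in a maximally entangled state gives F(S, M) ≤ f(M) and ½‖S − M‖ ≥ 1 − f(M) for every channel M
(`channelFidelity_swap_le`, `le_diamondDist_swap`).

Conversely, suppose M = f S + R with R completely positive. Then every output satisfies M(σ) ≥ f
S(σ), so operator monotonicity of the square root gives F(S, M) ≥ f. Moreover S − M = (1 − f) S − R
is a difference of two positive outputs of trace 1 − f, so ½‖S − M‖ ≤ 1 − f. Both errors therefore
equal 1 − sup F as soon as a set F of reals contains all attainable entanglement fidelities and each
f in F is realized by a simulation of the form f S + R (`swap_errors_eq`). The block-matrix program
fits the same scheme: the rank-one corner forces λ² ≤ f(M) (`sq_le_of_fromBlocks_posSemidef`), and Q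
= √f Γ reaches equality.

For d ≥ 2, F is the set of values Tr[ρK] over feasible points of the reduced program. The Choi
operator of S factors as Γ on AB' times Γ on BA'. Contracting the Choi operator of P with the four
products of Γ and d − Γ yields K, L, M, N. Partial transposition is self-adjoint for this pairing
and exchanges 1 ± Γ with 1 ± swap ≥ 0, whence the four inequalities (`swapFeasible_of_choi`). In the
other direction a feasible point is assembled into a Choi operator whose partial transpose
decomposes along the products (1 ± swap) ⊗ (1 ± swap), with the four slacks as coefficients
(`transposeBobChoi_swapChoi`). Only contractions are used, so no average over unitaries is needed.
For d = 1 there is a single channel and F = {1}. -/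

namespace BQT

/-! ### Trace norm estimates. -/

section TraceNorm

variable {n : Type*} [Fintype n] [DecidableEq n]

theorem exists_unitary_diagonalization {A : Matrix n n ℂ} (hA : A.IsHermitian) :
    ∃ (U : Matrix n n ℂ) (a : n → ℝ), Uᴴ * U = 1 ∧ U * Uᴴ = 1 ∧
      A = U * Matrix.diagonal (fun i => (a i : ℂ)) * Uᴴ := by
  refine ⟨hA.eigenvectorUnitary, hA.eigenvalues, ?_, ?_, ?_⟩
  · exact Unitary.coe_star_mul_self hA.eigenvectorUnitary
  · exact Unitary.coe_mul_star_self hA.eigenvectorUnitary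
  · exact hA.spectral_theorem

theorem trace_unitary_conj {U : Matrix n n ℂ} (hU : Uᴴ * U = 1) (X : Matrix n n ℂ) :
    (U * X * Uᴴ).trace = X.trace := by
  rw [Matrix.trace_mul_comm, ← Matrix.mul_assoc, hU, Matrix.one_mul]

theorem trace_eq_sum_unitary_conj {U : Matrix n n ℂ} (hU : U * Uᴴ = 1) (X : Matrix n n ℂ) :
    X.trace.re = ∑ i, ((Uᴴ * X * U) i i).re := by
  have h := trace_unitary_conj (U := Uᴴ) (by simpa using hU) X
  rw [Matrix.conjTranspose_conjTranspose] at h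
  rw [← h, Matrix.trace, Complex.re_sum]
  rfl

theorem conj_unitary_conj {U : Matrix n n ℂ} (hU : Uᴴ * U = 1) (D : Matrix n n ℂ) :
    Uᴴ * (U * D * Uᴴ) * U = D := by
  calc Uᴴ * (U * D * Uᴴ) * U = (Uᴴ * U) * D * (Uᴴ * U) := by simp only [Matrix.mul_assoc]
    _ = D := by rw [hU, Matrix.one_mul, Matrix.mul_one]

theorem sqrt_posSemidef (A : Matrix n n ℂ) : (CFC.sqrt A).PosSemidef :=
  Matrix.nonneg_iff_posSemidef.1 (CFC.sqrt_nonneg A)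

theorem sqrt_mul_sqrt {A : Matrix n n ℂ} (hA : A.PosSemidef) :
    CFC.sqrt A * CFC.sqrt A = A :=
  CFC.sqrt_mul_sqrt_self A (Matrix.nonneg_iff_posSemidef.2 hA)

theorem sqrt_eq_of_mul_self {A B : Matrix n n ℂ} (hB : B.PosSemidef) (h : B * B = A) :
    CFC.sqrt A = B :=
  CFC.sqrt_unique h (Matrix.nonneg_iff_posSemidef.2 hB)

theorem trace_mul_nonneg {A B : Matrix n n ℂ} (hA : A.PosSemidef) (hB : B.PosSemidef) :
    0 ≤ (A * B).trace := by
  have h := (hB.mul_mul_conjTranspose_same (CFC.sqrt A)).trace_nonneg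
  rwa [(sqrt_posSemidef A).isHermitian.eq, Matrix.trace_mul_comm, ← Matrix.mul_assoc,
    sqrt_mul_sqrt hA] at h

/-- In an eigenbasis of |X| the i-th column of X has norm equal to the i-th eigenvalue, which
therefore dominates the i-th diagonal entry. -/
theorem re_trace_le_traceNorm (X : Matrix n n ℂ) : X.trace.re ≤ traceNorm X := by
  have hXX : (Xᴴ * X).PosSemidef := Matrix.posSemidef_conjTranspose_mul_self X
  obtain ⟨U, s, hU, hU', hS⟩ :=
    exists_unitary_diagonalization (sqrt_posSemidef (Xᴴ * X)).isHermitian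
  have hD : Uᴴ * CFC.sqrt (Xᴴ * X) * U = Matrix.diagonal fun i => (s i : ℂ) := by
    rw [hS, conj_unitary_conj hU]
  have hs : ∀ i, 0 ≤ s i := fun i => by
    have h := ((sqrt_posSemidef (Xᴴ * X)).conjTranspose_mul_mul_same U).diag_nonneg (i := i)
    rw [hD, Matrix.diagonal_apply_eq] at h
    exact_mod_cast h
  set Y := Uᴴ * X * U with hY
  have hYY : Yᴴ * Y = Matrix.diagonal fun i => ((s i ^ 2 : ℝ) : ℂ) := by
    calc Yᴴ * Y = Uᴴ * (Xᴴ * (U * Uᴴ) * X) * U := by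
          simp only [hY, Matrix.conjTranspose_mul, Matrix.conjTranspose_conjTranspose,
            Matrix.mul_assoc]
      _ = Uᴴ * (CFC.sqrt (Xᴴ * X) * (U * Uᴴ) * CFC.sqrt (Xᴴ * X)) * U := by
          rw [hU', Matrix.mul_one, Matrix.mul_one, sqrt_mul_sqrt hXX]
      _ = (Uᴴ * CFC.sqrt (Xᴴ * X) * U) * (Uᴴ * CFC.sqrt (Xᴴ * X) * U) := by
          simp only [Matrix.mul_assoc]
      _ = _ := by
          rw [hD, Matrix.diagonal_mul_diagonal]
          congr 1
          ext i
          push_cast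
          ring
  have hle : ∀ i, (Y i i).re ≤ s i := fun i => by
    have h1 : ∑ k, ‖Y k i‖ ^ 2 = s i ^ 2 := by
      have h := congrFun (congrFun hYY i) i
      rw [Matrix.mul_apply, Matrix.diagonal_apply_eq] at h
      simp only [Matrix.conjTranspose_apply, RCLike.star_def, Complex.conj_mul'] at h
      exact_mod_cast h
    have h2 : ‖Y i i‖ ^ 2 ≤ s i ^ 2 := h1 ▸
      Finset.single_le_sum (f := fun k => ‖Y k i‖ ^ 2) (fun k _ => by positivity)
        (Finset.mem_univ i)
    exact (Complex.re_le_norm _).trans (abs_le_of_sq_le_sq' h2 (hs i)).2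
  have hN : traceNorm X = ∑ i, s i := by
    rw [traceNorm, hS, trace_unitary_conj hU, Matrix.trace_diagonal, Complex.re_sum]
    simp
  rw [trace_eq_sum_unitary_conj hU', hN]
  exact Finset.sum_le_sum fun i _ => hle i

theorem re_trace_mul_le_traceNorm {W : Matrix n n ℂ} (hW : Wᴴ * W = 1) (X : Matrix n n ℂ) :
    (W * X).trace.re ≤ traceNorm X := by
  have h : traceNorm (W * X) = traceNorm X := by
    rw [traceNorm, traceNorm, Matrix.conjTranspose_mul, Matrix.mul_assoc, ← Matrix.mul_assoc Wᴴ,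
      hW, Matrix.one_mul]
  exact h ▸ re_trace_le_traceNorm (W * X)

/-- In an eigenbasis of A − B each eigenvalue is a difference of nonnegative diagonal entries of A
and B, so its modulus is at most their sum. -/
theorem traceNorm_sub_le {A B : Matrix n n ℂ} (hA : A.PosSemidef) (hB : B.PosSemidef) :
    traceNorm (A - B) ≤ A.trace.re + B.trace.re := by
  have hX : (A - B).IsHermitian := hA.isHermitian.sub hB.isHermitian
  obtain ⟨U, x, hU, hU', hS⟩ := exists_unitary_diagonalization hX
  have hD : Uᴴ * (A - B) * U = Matrix.diagonal fun i => (x i : ℂ) := by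
    rw [hS, conj_unitary_conj hU]
  have habs : (Matrix.diagonal fun i => ((|x i| : ℝ) : ℂ)).PosSemidef :=
    Matrix.PosSemidef.diagonal fun i => Complex.zero_le_real.2 (abs_nonneg (x i))
  have hsqrt : CFC.sqrt ((A - B)ᴴ * (A - B)) =
      U * Matrix.diagonal (fun i => ((|x i| : ℝ) : ℂ)) * Uᴴ := by
    refine sqrt_eq_of_mul_self (habs.mul_mul_conjTranspose_same U) ?_
    rw [hX.eq, hS]
    calc U * Matrix.diagonal (fun i => ((|x i| : ℝ) : ℂ)) * Uᴴ *
          (U * Matrix.diagonal (fun i => ((|x i| : ℝ) : ℂ)) * Uᴴ)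
        = U * (Matrix.diagonal (fun i => ((|x i| : ℝ) : ℂ)) * (Uᴴ * U) *
            Matrix.diagonal (fun i => ((|x i| : ℝ) : ℂ))) * Uᴴ := by
          simp only [Matrix.mul_assoc]
      _ = U * (Matrix.diagonal (fun i => (x i : ℂ)) * (Uᴴ * U) *
            Matrix.diagonal (fun i => (x i : ℂ))) * Uᴴ := by
          simp only [hU, Matrix.mul_one, Matrix.diagonal_mul_diagonal, ← Complex.ofReal_mul,
            abs_mul_abs_self]
      _ = _ := by simp only [Matrix.mul_assoc]
  have hN : traceNorm (A - B) = ∑ i, |x i| := by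
    rw [traceNorm, hsqrt, trace_unitary_conj hU, Matrix.trace_diagonal, Complex.re_sum]
    simp
  rw [hN, trace_eq_sum_unitary_conj hU' A, trace_eq_sum_unitary_conj hU' B,
    ← Finset.sum_add_distrib]
  refine Finset.sum_le_sum fun i _ => ?_
  have hx : x i = ((Uᴴ * A * U) i i).re - ((Uᴴ * B * U) i i).re := by
    have h := congrFun (congrFun hD i) i
    rw [Matrix.mul_sub, Matrix.sub_mul, Matrix.sub_apply, Matrix.diagonal_apply_eq] at h
    simpa using (congrArg Complex.re h).symm
  have ha := (Complex.le_def.1 ((hA.conjTranspose_mul_mul_same U).diag_nonneg (i := i))).1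
  have hb := (Complex.le_def.1 ((hB.conjTranspose_mul_mul_same U).diag_nonneg (i := i))).1
  rw [Complex.zero_re] at ha hb
  rw [hx]
  exact abs_sub_le_iff.2 ⟨by linarith, by linarith⟩

end TraceNorm

/-! ### Fidelity: a lower bound from operator domination, and pure states. -/

section Fidelity

variable {n : Type*} [Fintype n] [DecidableEq n]

open scoped Matrix.Norms.L2Operator in
theorem sqrt_mono {A B : Matrix n n ℂ} (h : A ≤ B) : CFC.sqrt A ≤ CFC.sqrt B :=
  CFC.sqrt_le_sqrt A B h

theorem sqrt_real_smul {c : ℝ} (hc : 0 ≤ c) {A : Matrix n n ℂ} (hA : A.PosSemidef) :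
    CFC.sqrt ((c : ℂ) • A) = ((√c : ℝ) : ℂ) • CFC.sqrt A := by
  refine sqrt_eq_of_mul_self ((sqrt_posSemidef A).smul ?_) ?_
  · exact Complex.zero_le_real.2 (Real.sqrt_nonneg c)
  · rw [Matrix.smul_mul, Matrix.mul_smul, smul_smul, sqrt_mul_sqrt hA, ← Complex.ofReal_mul,
      Real.mul_self_sqrt hc]

/-- If `τ ≥ c ω` for a state `ω`, then `F(ω, τ) ≥ c`. -/
theorem le_fidelity_of_smul_le {c : ℝ} (hc : 0 ≤ c) {ω τ : Matrix n n ℂ} (hω : IsState ω)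
    (h : (c : ℂ) • ω ≤ τ) : c ≤ fidelity ω τ := by
  -- The square root is operator monotone, so pairing with √ω bounds Tr √ω√τ below by √c Tr ω,
  -- whether or not ω and τ commute.
  have h1 : ((√c : ℝ) : ℂ) • CFC.sqrt ω ≤ CFC.sqrt τ := by
    rw [← sqrt_real_smul hc hω.1]
    exact sqrt_mono h
  have h2 := trace_mul_nonneg (sqrt_posSemidef ω) (Matrix.le_iff.1 h1)
  rw [Matrix.mul_sub, Matrix.mul_smul, sqrt_mul_sqrt hω.1, Matrix.trace_sub, Matrix.trace_smul,
    hω.2] at h2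
  have h3 : √c ≤ (CFC.sqrt ω * CFC.sqrt τ).trace.re := by
    have := (Complex.le_def.1 h2).1
    simpa using this
  have h4 := h3.trans (re_trace_le_traceNorm _)
  calc c = √c ^ 2 := (Real.sq_sqrt hc).symm
    _ ≤ _ := by
      rw [fidelity]
      gcongr

theorem fidelity_nonneg (ω τ : Matrix n n ℂ) : 0 ≤ fidelity ω τ := sq_nonneg _

/-- The root of vv† is vv† / ‖v‖, of trace ‖v‖. -/
theorem traceNorm_sq_of_conjTranspose_mul_self {X : Matrix n n ℂ} {v : n → ℂ}
    (h : Xᴴ * X = Matrix.vecMulVec v (star v)) :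
    traceNorm X ^ 2 = (v ⬝ᵥ star v).re := by
  obtain ⟨r, hr, hvr⟩ : ∃ r : ℝ, 0 ≤ r ∧ v ⬝ᵥ star v = ((r ^ 2 : ℝ) : ℂ) := by
    refine ⟨√(∑ i, ‖v i‖ ^ 2), Real.sqrt_nonneg _, ?_⟩
    rw [Real.sq_sqrt (by positivity)]
    simp [dotProduct, Complex.mul_conj']
  -- For v = 0 the convention `0⁻¹ = 0` keeps the formula correct.
  have hsqrt : CFC.sqrt (Xᴴ * X) = ((r⁻¹ : ℝ) : ℂ) • Matrix.vecMulVec v (star v) := by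
    refine sqrt_eq_of_mul_self ((Matrix.posSemidef_vecMulVec_self_star v).smul ?_) ?_
    · exact Complex.zero_le_real.2 (inv_nonneg.2 hr)
    · rw [h, Matrix.smul_mul, Matrix.mul_smul, Matrix.vecMulVec_mul_vecMulVec, smul_smul,
        dotProduct_comm, hvr]
      rcases eq_or_ne r 0 with rfl | h0
      · have : v = 0 := by
          rw [← dotProduct_self_star_eq_zero (v := v), hvr]
          simp
        simp [this]
      · rw [Matrix.vecMulVec_smul, smul_smul]
        have h1 : ((r⁻¹ : ℝ) : ℂ) * ((r⁻¹ : ℝ) : ℂ) * ((r ^ 2 : ℝ) : ℂ) = 1 := by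
          rw [← Complex.ofReal_mul, ← Complex.ofReal_mul, ← Complex.ofReal_one]
          congr 1
          field_simp
        rw [h1, one_smul]
  rw [traceNorm, hsqrt, Matrix.trace_smul, Matrix.trace_vecMulVec, hvr, smul_eq_mul,
    ← Complex.ofReal_mul, Complex.ofReal_re, Complex.ofReal_re]
  rcases eq_or_ne r 0 with rfl | h0
  · simp
  · field_simp

/-- The fidelity with a pure state. -/
theorem fidelity_pure {φ : n → ℂ} (hφ : star φ ⬝ᵥ φ = 1) {τ : Matrix n n ℂ} (hτ : τ.PosSemidef) :
    fidelity (Matrix.vecMulVec φ (star φ)) τ = (star φ ⬝ᵥ τ *ᵥ φ).re := by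
  have hsq : CFC.sqrt (Matrix.vecMulVec φ (star φ)) = Matrix.vecMulVec φ (star φ) := by
    refine sqrt_eq_of_mul_self (Matrix.posSemidef_vecMulVec_self_star φ) ?_
    rw [Matrix.vecMulVec_mul_vecMulVec, hφ]
    simp
  have hH := (sqrt_posSemidef τ).isHermitian.eq
  have hv : star (CFC.sqrt τ *ᵥ φ) = star φ ᵥ* CFC.sqrt τ := by
    rw [Matrix.star_mulVec, hH]
  rw [fidelity, hsq, traceNorm_sq_of_conjTranspose_mul_self (v := CFC.sqrt τ *ᵥ φ)]
  · rw [hv, dotProduct_comm, ← Matrix.dotProduct_mulVec, Matrix.mulVec_mulVec, sqrt_mul_sqrt hτ]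
  · rw [hv, Matrix.conjTranspose_mul, hH, Matrix.conjTranspose_vecMulVec, star_star,
      Matrix.mul_assoc, ← Matrix.mul_assoc (Matrix.vecMulVec φ _), Matrix.vecMulVec_mul_vecMulVec,
      hφ, one_smul, Matrix.vecMulVec_mul, Matrix.mul_vecMulVec]

end Fidelity


/-! ### The Choi correspondence for complete positivity and trace preservation. -/

section Choi

variable {m n k : Type*}

theorem ampliate_add (N M : Superop m n) (X : Matrix (k × m) (k × m) ℂ) :
    ampliate (N + M) X = ampliate N X + ampliate M X := rfl

theorem ampliate_smul (c : ℂ) (N : Superop m n) (X : Matrix (k × m) (k × m) ℂ) :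
    ampliate (c • N) X = c • ampliate N X := rfl

theorem ampliate_smul_right (c : ℂ) (N : Superop m n) (X : Matrix (k × m) (k × m) ℂ) :
    ampliate N (c • X) = c • ampliate N X := by
  ext p q
  have h : (Matrix.of fun i j => (c • X) (p.1, i) (q.1, j)) =
    c • Matrix.of fun i j => X (p.1, i) (q.1, j) := rfl
  rw [ampliate, Matrix.of_apply, h, map_smul]
  rfl

theorem ampliate_submatrix {l : Type*} (N : Superop m n) (X : Matrix (k × m) (k × m) ℂ)
    (e : l → k) :
    ampliate N (X.submatrix (Prod.map e id) (Prod.map e id)) =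
      (ampliate N X).submatrix (Prod.map e id) (Prod.map e id) := rfl

theorem trace_ampliate [Fintype k] [Fintype m] [Fintype n] {N : Superop m n}
    (hN : ∀ X, (N X).trace = X.trace) (X : Matrix (k × m) (k × m) ℂ) :
    (ampliate N X).trace = X.trace := by
  rw [Matrix.trace, Matrix.trace, Fintype.sum_prod_type, Fintype.sum_prod_type]
  exact Finset.sum_congr rfl fun i _ => hN (Matrix.of fun a b => X (i, a) (i, b))

variable [Fintype m]

/-- The superoperator with a given Choi operator. -/
noncomputable def ofChoi (C : Matrix (m × n) (m × n) ℂ) : Superop m n where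
  toFun X := Matrix.of fun a b => ∑ i, ∑ j, X i j * C (i, a) (j, b)
  map_add' X Y := by
    ext a b
    simp [add_mul, Finset.sum_add_distrib]
  map_smul' c X := by
    ext a b
    simp [Finset.mul_sum, mul_assoc]

theorem ofChoi_apply (C : Matrix (m × n) (m × n) ℂ) (X : Matrix m m ℂ) (a b : n) :
    ofChoi C X a b = ∑ i, ∑ j, X i j * C (i, a) (j, b) := rfl

variable [DecidableEq m]

omit [Fintype m] in
theorem choi_apply (N : Superop m n) (p q : m × n) :
    choi N p q = N (Matrix.single p.1 q.1 1) p.2 q.2 := by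
  rw [choi, ampliate, Matrix.of_apply]
  congr 2

theorem choi_ofChoi (C : Matrix (m × n) (m × n) ℂ) : choi (ofChoi C) = C := by
  ext ⟨i, a⟩ ⟨j, b⟩
  rw [choi_apply, ofChoi_apply]
  simp [Matrix.single_apply, ite_and]

theorem ofChoi_choi (N : Superop m n) : ofChoi (choi N) = N := by
  refine LinearMap.ext fun X => ?_
  ext a b
  conv_rhs => rw [Matrix.matrix_eq_sum_single X]
  simp only [ofChoi_apply, choi_apply, map_sum, Matrix.sum_apply]
  refine Finset.sum_congr rfl fun i _ => Finset.sum_congr rfl fun j _ => ?_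
  have h : Matrix.single i j (X i j) = X i j • Matrix.single i j (1 : ℂ) := by
    simp
  rw [h, map_smul]
  rfl

theorem choi_injective : Function.Injective (choi : Superop m n → _) :=
  Function.LeftInverse.injective ofChoi_choi

theorem posSemidef_ampliate_of_choi [Fintype k] [Fintype n] {N : Superop m n}
    (hN : (choi N).PosSemidef) {X : Matrix (k × m) (k × m) ℂ} (hX : X.PosSemidef) :
    (ampliate N X).PosSemidef := by
  classical
  obtain ⟨B, hB⟩ : ∃ B : Matrix (m × n) (m × n) ℂ, choi N = B * Bᴴ :=
    ⟨CFC.sqrt (choi N), by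
      rw [(sqrt_posSemidef (choi N)).isHermitian.eq, sqrt_mul_sqrt hN]⟩
  -- Kraus decomposition: column s of a root of the Choi operator, reshaped, is the s-th Kraus
  -- operator, here tensored with the identity of the reference.
  have h : ampliate N X = ∑ s, Matrix.of (fun (p : k × n) (q : k × m) =>
      if p.1 = q.1 then B (q.2, p.2) s else 0) * X *
        (Matrix.of (fun (p : k × n) (q : k × m) => if p.1 = q.1 then B (q.2, p.2) s else 0))ᴴ := by
    ext ⟨r, a⟩ ⟨t, b⟩
    conv_lhs => rw [← ofChoi_choi N, hB]
    rw [ampliate, Matrix.of_apply, ofChoi_apply, Matrix.sum_apply]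
    simp only [Matrix.mul_apply, Matrix.conjTranspose_apply, Matrix.of_apply,
      Fintype.sum_prod_type (f := fun x : k × m => _), ite_mul, zero_mul, Finset.sum_ite_irrel,
      Finset.sum_const_zero, Finset.sum_ite_eq, Finset.mem_univ, if_true, apply_ite star, star_zero,
      mul_ite, mul_zero, Finset.mul_sum, Finset.sum_mul]
    rw [Finset.sum_comm]
    simp only [Finset.sum_comm (s := (Finset.univ : Finset (m × n))) (t := (Finset.univ : Finset m))]
    refine Finset.sum_congr rfl fun i _ => Finset.sum_congr rfl fun j _ =>
      Finset.sum_congr rfl fun s _ => ?_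
    ring
  rw [h]
  exact Matrix.posSemidef_sum _ fun s _ => hX.mul_mul_conjTranspose_same _

theorem ofChoi_posSemidef [Fintype n] {C : Matrix (m × n) (m × n) ℂ} (hC : C.PosSemidef)
    {X : Matrix m m ℂ} (hX : X.PosSemidef) : (ofChoi C X).PosSemidef := by
  rw [← choi_ofChoi C] at hC
  exact (posSemidef_ampliate_of_choi (k := Unit) hC (hX.submatrix Prod.snd)).submatrix
    fun a => ((), a)

omit [Fintype m] in
theorem maxEnt_eq_vecMulVec :
    maxEnt m = Matrix.vecMulVec (fun p : m × m => if p.1 = p.2 then (1 : ℂ) else 0)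
      (star fun p : m × m => if p.1 = p.2 then (1 : ℂ) else 0) := by
  ext p q
  simp [maxEnt, Matrix.vecMulVec_apply, ite_and, apply_ite star]
  split_ifs <;> rfl

omit [Fintype m] in
theorem maxEnt_posSemidef [Finite m] : (maxEnt m).PosSemidef := by
  have := Fintype.ofFinite m
  rw [maxEnt_eq_vecMulVec]
  exact Matrix.posSemidef_vecMulVec_self_star _

theorem isCP_iff_choi_posSemidef [Fintype n] {N : Superop m n} :
    IsCP N ↔ (choi N).PosSemidef := by
  refine ⟨fun h => ?_, fun h r X hX => posSemidef_ampliate_of_choi h hX⟩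
  -- Complete positivity is tested on references `Fin r`, so the maximally entangled operator is
  -- first reindexed.
  have h1 := h (Fintype.card m) _
    ((maxEnt_posSemidef (m := m)).submatrix (Prod.map (Fintype.equivFin m).symm id))
  rw [ampliate_submatrix] at h1
  exact (Matrix.posSemidef_submatrix_equiv
    (Equiv.prodCongr (Fintype.equivFin m).symm (Equiv.refl n))).1 h1

theorem trace_preserving_iff [Fintype n] {N : Superop m n} :
    (∀ X, (N X).trace = X.trace) ↔ traceSnd (choi N) = 1 := by
  constructor
  · intro h
    ext i j
    have h1 := h (Matrix.single i j 1)
    rw [Matrix.trace] at h1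
    simp only [traceSnd, Matrix.of_apply, choi_apply]
    rw [Matrix.one_apply]
    refine h1.trans ?_
    split_ifs with hij
    · rw [hij, Matrix.trace_single_eq_same]
    · exact Matrix.trace_single_eq_of_ne i j 1 hij
  · intro h X
    conv_lhs => rw [← ofChoi_choi N, Matrix.trace]
    simp only [Matrix.diag_apply, ofChoi_apply]
    have h1 : ∀ i j, ∑ a, choi N (i, a) (j, a) = if i = j then 1 else 0 := fun i j => by
      rw [← Matrix.one_apply, ← h]
      rfl
    rw [Finset.sum_comm]
    simp only [Finset.sum_comm (s := (Finset.univ : Finset n)) (t := (Finset.univ : Finset m)),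
      ← Finset.mul_sum, h1]
    simp [Matrix.trace]

end Choi

/-! ### Choi operators of simulations and of C-PPT-P channels. -/

section Simulation

variable {A B A₂ B₂ E G : Type*}
variable [Fintype A] [Fintype B] [Fintype A₂] [Fintype B₂] [Fintype E] [Fintype G]
variable [DecidableEq A] [DecidableEq B] [DecidableEq E] [DecidableEq G]

omit [Fintype A] [Fintype B] [Fintype A₂] [Fintype B₂] [Fintype E] [Fintype G] in
theorem choi_partialTranspose (P : Superop ((A × B) × (E × G)) (A₂ × B₂)) :
    choi (transposeSnd ∘ₗ P ∘ₗ transposeBob) = transposeBobChoi (choi P) := by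
  ext ⟨⟨⟨a, b⟩, ⟨e, g⟩⟩, ⟨a', b'⟩⟩ ⟨⟨⟨c, d⟩, ⟨f, h⟩⟩, ⟨c', d'⟩⟩
  simp only [transposeBobChoi, Matrix.of_apply, choi_apply]
  have h1 : transposeBob (Matrix.single ((a, b), (e, g)) ((c, d), (f, h)) (1 : ℂ)) =
      Matrix.single ((a, d), (e, h)) ((c, b), (f, g)) 1 := by
    ext ⟨⟨x, y⟩, ⟨z, w⟩⟩ ⟨⟨x', y'⟩, ⟨z', w'⟩⟩
    change Matrix.single ((a, b), (e, g)) ((c, d), (f, h)) (1 : ℂ) ((x, y'), (z, w'))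
      ((x', y), (z', w)) = _
    simp only [Matrix.single_apply, Prod.mk.injEq]
    exact if_congr (by tauto) rfl rfl
  rw [LinearMap.comp_apply, LinearMap.comp_apply, h1]
  rfl

theorem isCPPTP_iff (P : Superop ((A × B) × (E × G)) (A₂ × B₂)) :
    IsCPPTP P ↔ 0 ≤ choi P ∧ 0 ≤ transposeBobChoi (choi P) ∧ traceSnd (choi P) = 1 := by
  rw [IsCPPTP, IsChannel, isCP_iff_choi_posSemidef, isCP_iff_choi_posSemidef,
    trace_preserving_iff, choi_partialTranspose, Matrix.nonneg_iff_posSemidef,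
    Matrix.nonneg_iff_posSemidef]
  tauto

omit [Fintype A₂] [Fintype B₂] in
theorem choi_simulate (P : Superop ((A × B) × (E × G)) (A₂ × B₂)) (ρ : Matrix (E × G) (E × G) ℂ) :
    choi (simulate P ρ) = contractResource ρ (choi P) := by
  ext ⟨i, a⟩ ⟨j, b⟩
  have h : choi (simulate P ρ) (i, a) (j, b) = P (Matrix.single i j 1 ⊗ₖ ρ) a b := by
    rw [choi_apply]
    rfl
  rw [h, ← ofChoi_choi P, ofChoi_apply, choi_ofChoi]
  simp only [contractResource, Matrix.of_apply, Matrix.transpose_apply]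
  conv_rhs => rw [Finset.sum_comm]
  rw [Fintype.sum_prod_type, Finset.sum_eq_single i]
  · refine Finset.sum_congr rfl fun l _ => ?_
    rw [Fintype.sum_prod_type, Finset.sum_eq_single j]
    · refine Finset.sum_congr rfl fun h _ => ?_
      rw [Matrix.kronecker_apply, Matrix.single_apply_same, one_mul]
    · intro y _ hy
      refine Finset.sum_eq_zero fun h _ => ?_
      rw [Matrix.kronecker_apply, Matrix.single_apply_of_col_ne _ _ hy.symm, zero_mul, zero_mul]
    · simp
  · intro x _ hx
    refine Finset.sum_eq_zero fun l _ => Finset.sum_eq_zero fun y _ => ?_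
    rw [Matrix.kronecker_apply, Matrix.single_apply_of_row_ne hx.symm, zero_mul, zero_mul]
  · simp

omit [DecidableEq A] [DecidableEq B] in
-- After reordering the systems, this is the map out of the resource systems with Choi operator P,
-- applied to ρ.
theorem contractResource_posSemidef {ρ : Matrix (E × G) (E × G) ℂ}
    {P : Matrix (((A × B) × (E × G)) × (A₂ × B₂)) (((A × B) × (E × G)) × (A₂ × B₂)) ℂ}
    (hρ : ρ.PosSemidef) (hP : P.PosSemidef) : (contractResource ρ P).PosSemidef := by
  have h := ofChoi_posSemidef (hP.submatrix
    fun x : (E × G) × ((A × B) × (A₂ × B₂)) => ((x.2.1, x.1), x.2.2)) hρ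
  convert h using 1
  ext p q
  simp only [contractResource, Matrix.of_apply, Matrix.transpose_apply]
  rw [Finset.sum_comm]
  rfl

theorem isChannel_simulate {P : Superop ((A × B) × (E × G)) (A₂ × B₂)} (hP : IsChannel P)
    {ρ : Matrix (E × G) (E × G) ℂ} (hρ : IsState ρ) : IsChannel (simulate P ρ) := by
  refine ⟨isCP_iff_choi_posSemidef.2 ?_, fun X => ?_⟩
  · rw [choi_simulate]
    exact contractResource_posSemidef hρ.1 (isCP_iff_choi_posSemidef.1 hP.1)
  · rw [show simulate P ρ X = P (X ⊗ₖ ρ) from rfl, hP.2, Matrix.trace_kronecker, hρ.2, mul_one]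

end Simulation


/-! ### The swap channel and the entanglement fidelity. -/

section SwapChannel

variable {d : ℕ}

theorem swapOp_apply (p q : Fin d × Fin d) :
    swapOp d p q = if p.1 = q.2 ∧ p.2 = q.1 then 1 else 0 := by
  have h : ∀ i j : Fin d, (Matrix.single i j (1 : ℂ) ⊗ₖ Matrix.single j i (1 : ℂ)) p q =
      (if i = p.1 ∧ j = q.1 then 1 else 0) * (if j = p.2 ∧ i = q.2 then 1 else 0) := fun i j => by
    rw [Matrix.kronecker_apply, Matrix.single_apply, Matrix.single_apply]
  simp only [swapOp, Matrix.sum_apply, h]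
  rw [Finset.sum_eq_single p.1, Finset.sum_eq_single p.2]
  · by_cases h1 : p.1 = q.2 <;> by_cases h2 : p.2 = q.1 <;> simp [h1, h2]
  · intro j _ hj
    simp [hj]
  · simp
  · intro i _ hi
    simp [hi]
  · simp

theorem swapOp_mul_apply (Y : Matrix (Fin d × Fin d) (Fin d × Fin d) ℂ) (p q : Fin d × Fin d) :
    (swapOp d * Y) p q = Y p.swap q := by
  rw [Matrix.mul_apply, Finset.sum_eq_single p.swap]
  · simp [swapOp_apply]
  · intro x _ hx
    rw [swapOp_apply, if_neg, zero_mul]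
    rintro ⟨h1, h2⟩
    exact hx (Prod.ext h2.symm h1.symm)
  · simp

theorem swapChannel_apply (X : Matrix (Fin d × Fin d) (Fin d × Fin d) ℂ) (p q : Fin d × Fin d) :
    swapChannel d X p q = X p.swap q.swap := by
  have h' : swapChannel d X = (swapOp d * (swapOp d * X)ᴴ)ᴴ := by
    rw [Matrix.conjTranspose_mul, Matrix.conjTranspose_conjTranspose]
    rfl
  rw [h', Matrix.conjTranspose_apply, swapOp_mul_apply, Matrix.conjTranspose_apply, star_star,
    swapOp_mul_apply]

/-- The unnormalized vector whose projection is the Choi operator of the swap channel. -/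
noncomputable def swapVec (d : ℕ) : (Fin d × Fin d) × (Fin d × Fin d) → ℂ :=
  fun p => if p.1 = p.2.swap then 1 else 0

theorem star_swapVec : star (swapVec d) = swapVec d := by
  ext p
  simp [swapVec, apply_ite star]

theorem choi_swapChannel :
    choi (swapChannel d) = Matrix.vecMulVec (swapVec d) (star (swapVec d)) := by
  ext p q
  rw [choi_apply, swapChannel_apply, star_swapVec, Matrix.vecMulVec_apply, Matrix.single_apply,
    swapVec, swapVec]
  by_cases h1 : p.1 = p.2.swap <;> by_cases h2 : q.1 = q.2.swap <;> simp [h1, h2]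

theorem swapVec_dotProduct_self : star (swapVec d) ⬝ᵥ swapVec d = (d : ℂ) ^ 2 := by
  rw [star_swapVec, dotProduct, Fintype.sum_prod_type, Finset.sum_comm]
  simp [swapVec, sq]

theorem isChannel_swapChannel : IsChannel (swapChannel d) := by
  refine ⟨isCP_iff_choi_posSemidef.2 ?_, fun X => ?_⟩
  · rw [choi_swapChannel]
    exact Matrix.posSemidef_vecMulVec_self_star _
  · simp only [Matrix.trace, Matrix.diag_apply, swapChannel_apply]
    exact (Equiv.prodComm (Fin d) (Fin d)).sum_comp fun p => X p p

/-- The entanglement fidelity of a superoperator with the swap channel. -/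
noncomputable def swapEntFid (d : ℕ) (M : Superop (Fin d × Fin d) (Fin d × Fin d)) : ℝ :=
  (star (swapVec d) ⬝ᵥ choi M *ᵥ swapVec d).re / d ^ 4

theorem exists_maximally_entangled_input (hd : 1 ≤ d) :
    ∃ (r : ℕ) (σ : Matrix (Fin r × (Fin d × Fin d)) (Fin r × (Fin d × Fin d)) ℂ)
      (φ : Fin r × (Fin d × Fin d) → ℂ), IsState σ ∧ star φ ⬝ᵥ φ = 1 ∧
      ampliate (swapChannel d) σ = Matrix.vecMulVec φ (star φ) ∧
      ∀ M, (star φ ⬝ᵥ ampliate M σ *ᵥ φ).re = swapEntFid d M := by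
  have hd0 : (d : ℂ) ≠ 0 := by exact_mod_cast (by omega : d ≠ 0)
  let e : Fin (Fintype.card (Fin d × Fin d)) × (Fin d × Fin d) ≃
      (Fin d × Fin d) × (Fin d × Fin d) :=
    Equiv.prodCongr (Fintype.equivFin (Fin d × Fin d)).symm (Equiv.refl _)
  -- The input AB has dimension d², which is the trace of the unnormalized maximally entangled
  -- operator; correspondingly φ is γ / d.
  let c : ℂ := ((((d : ℝ) ^ 2)⁻¹ : ℝ) : ℂ)
  have hc : c = ((d : ℂ) ^ 2)⁻¹ := by
    simp [c]
  let σ : Matrix (Fin (Fintype.card (Fin d × Fin d)) × (Fin d × Fin d))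
      (Fin (Fintype.card (Fin d × Fin d)) × (Fin d × Fin d)) ℂ :=
    c • (maxEnt (Fin d × Fin d)).submatrix e e
  have hamp : ∀ M, ampliate M σ = c • (choi M).submatrix e e := fun M => by
    rw [show ampliate M σ = c • ampliate M ((maxEnt (Fin d × Fin d)).submatrix e e) from
      ampliate_smul_right c M _]
    rfl
  let φ : Fin (Fintype.card (Fin d × Fin d)) × (Fin d × Fin d) → ℂ :=
    (d : ℂ)⁻¹ • (swapVec d ∘ e)
  have hφ' : star φ = (d : ℂ)⁻¹ • (star (swapVec d) ∘ e) := by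
    ext p
    simp [φ]
  refine ⟨_, σ, φ, ⟨?_, ?_⟩, ?_, ?_, fun M => ?_⟩
  · exact (maxEnt_posSemidef.submatrix e).smul (Complex.zero_le_real.2 (by positivity))
  · rw [Matrix.trace_smul, Matrix.trace]
    simp only [Matrix.diag_apply, Matrix.submatrix_apply]
    rw [e.sum_comp fun p => maxEnt (Fin d × Fin d) p p, Fintype.sum_prod_type, hc]
    simp only [maxEnt, Matrix.of_apply, and_self, Finset.sum_ite_eq, Finset.mem_univ, if_true,
      Finset.sum_const, Finset.card_univ, Fintype.card_prod, Fintype.card_fin, smul_eq_mul]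
    simp
    field_simp
  · rw [hφ', smul_dotProduct, dotProduct_smul, comp_equiv_dotProduct_comp_equiv,
      swapVec_dotProduct_self, smul_eq_mul, smul_eq_mul]
    field_simp
  · rw [hamp, choi_swapChannel, hφ', Matrix.smul_vecMulVec, Matrix.vecMulVec_smul, smul_smul, hc,
      sq, mul_inv]
    rfl
  · have h : star φ ⬝ᵥ ampliate M σ *ᵥ φ =
        (((d : ℝ) ^ 4)⁻¹ : ℝ) * (star (swapVec d) ⬝ᵥ choi M *ᵥ swapVec d) := by
      rw [hamp, hφ', Matrix.smul_mulVec, Matrix.mulVec_smul, Matrix.submatrix_mulVec_equiv,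
        smul_dotProduct, dotProduct_smul, dotProduct_smul, Function.comp_assoc, e.self_comp_symm,
        Function.comp_id, comp_equiv_dotProduct_comp_equiv, smul_eq_mul, smul_eq_mul, smul_eq_mul,
        hc]
      push_cast
      field_simp
    rw [h, Complex.re_ofReal_mul, swapEntFid, div_eq_inv_mul]

end SwapChannel

/-! ### Both error measures bounded by the entanglement fidelity. -/

section Bounds

variable {d : ℕ} {M R : Superop (Fin d × Fin d) (Fin d × Fin d)}

theorem isState_ampliate {m n k : Type*} [Fintype m] [DecidableEq m] [Fintype n] [Fintype k]
    {N : Superop m n} (hN : IsChannel N) {σ : Matrix (k × m) (k × m) ℂ} (hσ : IsState σ) :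
    IsState (ampliate N σ) :=
  ⟨posSemidef_ampliate_of_choi (isCP_iff_choi_posSemidef.1 hN.1) hσ.1,
    (trace_ampliate hN.2 σ).trans hσ.2⟩

theorem traceNorm_sub_le_two {n : Type*} [Fintype n] [DecidableEq n] {ω τ : Matrix n n ℂ}
    (hω : IsState ω) (hτ : IsState τ) : traceNorm (ω - τ) ≤ 2 := by
  have h := traceNorm_sub_le hω.1 hτ.1
  rw [hω.2, hτ.2] at h
  norm_num at h
  exact h

/-- The reflection 2φφ† − 1 is unitary, and its pairing with φφ† − τ is twice the left-hand side. -/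
theorem le_traceNorm_pure_sub {n : Type*} [Fintype n] [DecidableEq n] {φ : n → ℂ}
    (hφ : star φ ⬝ᵥ φ = 1) {τ : Matrix n n ℂ} (hτ : IsState τ) :
    1 - (star φ ⬝ᵥ τ *ᵥ φ).re ≤ 1 / 2 * traceNorm (Matrix.vecMulVec φ (star φ) - τ) := by
  set ω := Matrix.vecMulVec φ (star φ) with hω
  have hωω : ω * ω = ω := by
    rw [hω, Matrix.vecMulVec_mul_vecMulVec, hφ, one_smul]
  have hωH : ωᴴ = ω := (Matrix.posSemidef_vecMulVec_self_star φ).isHermitian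
  have hW : ((2 : ℂ) • ω - 1)ᴴ * ((2 : ℂ) • ω - 1) = 1 := by
    rw [Matrix.conjTranspose_sub, Matrix.conjTranspose_smul, hωH, Matrix.conjTranspose_one,
      Matrix.sub_mul, Matrix.mul_sub, Matrix.mul_sub, Matrix.smul_mul, Matrix.mul_smul, hωω]
    simp only [Matrix.one_mul, Matrix.mul_one, RCLike.star_def, Complex.conj_ofNat, smul_smul]
    module
  have h := re_trace_mul_le_traceNorm hW (ω - τ)
  have h1 : ω.trace = 1 := by
    rw [hω, Matrix.trace_vecMulVec, dotProduct_comm, hφ]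
  have h2 : (ω * τ).trace = star φ ⬝ᵥ τ *ᵥ φ := by
    rw [hω, Matrix.vecMulVec_mul, Matrix.trace_vecMulVec, dotProduct_comm,
      ← Matrix.dotProduct_mulVec]
  have h3 : (((2 : ℂ) • ω - 1) * (ω - τ)).trace = 2 * (1 - star φ ⬝ᵥ τ *ᵥ φ) := by
    rw [Matrix.sub_mul, Matrix.smul_mul, Matrix.mul_sub, hωω, Matrix.one_mul, Matrix.trace_sub,
      Matrix.trace_smul, Matrix.trace_sub, Matrix.trace_sub, h1, h2, hτ.2, sub_self, sub_zero,
      smul_eq_mul]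
  rw [h3] at h
  simp at h
  linarith

theorem channelFidelity_swap_le (hd : 1 ≤ d) (hM : IsChannel M) :
    channelFidelity (swapChannel d) M ≤ swapEntFid d M := by
  obtain ⟨r, σ, φ, hσ, hφ, hS, hF⟩ := exists_maximally_entangled_input hd
  refine csInf_le ⟨0, ?_⟩ ⟨r, σ, hσ, ?_⟩
  · rintro x ⟨r, σ, -, rfl⟩
    exact fidelity_nonneg _ _
  · rw [hS, fidelity_pure hφ (isState_ampliate hM hσ).1, hF]

theorem le_diamondDist_swap (hd : 1 ≤ d) (hM : IsChannel M) :
    1 - swapEntFid d M ≤ 1 / 2 * diamondDist (swapChannel d) M := by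
  obtain ⟨r, σ, φ, hσ, hφ, hS, hF⟩ := exists_maximally_entangled_input hd
  have h1 := le_traceNorm_pure_sub hφ (isState_ampliate hM hσ)
  have h2 : traceNorm (ampliate (swapChannel d) σ - ampliate M σ) ≤
      diamondDist (swapChannel d) M := by
    refine le_csSup ⟨2, ?_⟩ ⟨r, σ, hσ, rfl⟩
    rintro x ⟨r, σ, hσ, rfl⟩
    exact traceNorm_sub_le_two (isState_ampliate isChannel_swapChannel hσ)
      (isState_ampliate hM hσ)
  rw [hF, ← hS] at h1
  linarith

theorem le_channelFidelity_swap (hd : 1 ≤ d) {f : ℝ} (hf : 0 ≤ f) (hR : IsCP R)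
    (hM : M = (f : ℂ) • swapChannel d + R) : f ≤ channelFidelity (swapChannel d) M := by
  -- Only the existence of an input state matters here: the infimum must not run over the empty set.
  obtain ⟨r, σ, φ, hσ, -⟩ := exists_maximally_entangled_input hd
  refine le_csInf ⟨_, r, σ, hσ, rfl⟩ ?_
  rintro x ⟨r, σ, hσ, rfl⟩
  refine le_fidelity_of_smul_le hf (isState_ampliate isChannel_swapChannel hσ) ?_
  rw [hM, ampliate_add, ampliate_smul]
  exact le_add_of_nonneg_right (Matrix.nonneg_iff_posSemidef.2
    (posSemidef_ampliate_of_choi (isCP_iff_choi_posSemidef.1 hR) hσ.1))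

/-- The outputs differ by (1 − f) S(σ) − R(σ), and trace preservation of M makes both terms have
trace 1 − f. -/
theorem diamondDist_swap_le (hd : 1 ≤ d) {f : ℝ} (hf : f ≤ 1) (hMc : IsChannel M) (hR : IsCP R)
    (hM : M = (f : ℂ) • swapChannel d + R) :
    1 / 2 * diamondDist (swapChannel d) M ≤ 1 - f := by
  obtain ⟨r, σ, φ, hσ, -⟩ := exists_maximally_entangled_input hd
  have h : diamondDist (swapChannel d) M ≤ 2 * (1 - f) := by
    refine csSup_le ⟨_, r, σ, hσ, rfl⟩ ?_
    rintro x ⟨r, σ, hσ, rfl⟩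
    have hS := isState_ampliate isChannel_swapChannel hσ
    have hMσ := (isState_ampliate hMc hσ).2
    have hRσ := posSemidef_ampliate_of_choi (isCP_iff_choi_posSemidef.1 hR) hσ.1
    have h1 : ampliate (swapChannel d) σ - ampliate M σ =
        ((1 - f : ℝ) : ℂ) • ampliate (swapChannel d) σ - ampliate R σ := by
      rw [hM, ampliate_add, ampliate_smul]
      push_cast
      module
    have h2 := traceNorm_sub_le
      (hS.1.smul (Complex.zero_le_real.2 (sub_nonneg.2 hf))) hRσ
    have h3 : (ampliate R σ).trace.re = 1 - f := by
      rw [hM, ampliate_add, ampliate_smul, Matrix.trace_add, Matrix.trace_smul, hS.2] at hMσ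
      have := congrArg Complex.re hMσ
      simp at this
      linarith
    rw [h1]
    refine h2.trans ?_
    rw [h3, Matrix.trace_smul, hS.2]
    simp
    linarith
  linarith

end Bounds

/-! ### The block-matrix constraint of the fidelity program. -/

section BlockMatrix

variable {d : ℕ}

/-- The rank-one corner forces Q = (Qγ)γ† / d², so ⟨γ, Qγ⟩ = d² Tr Q, whose real part is at least l
d⁴ by the trace of `hQ`. Testing positivity on a vector built from γ then gives the bound. -/
theorem sq_le_of_fromBlocks_posSemidef (hd : 1 ≤ d) {l : ℝ} (hl : 0 ≤ l)
    {M : Superop (Fin d × Fin d) (Fin d × Fin d)}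
    {Q : Matrix ((Fin d × Fin d) × (Fin d × Fin d)) ((Fin d × Fin d) × (Fin d × Fin d)) ℂ}
    (hQ : l • (1 : Matrix (Fin d × Fin d) (Fin d × Fin d) ℂ) ≤ hermPart (traceSnd Q))
    (hB : (Matrix.fromBlocks (choi (swapChannel d)) Qᴴ Q (choi M)).PosSemidef) :
    l ^ 2 ≤ swapEntFid d M := by
  have hdr : (0 : ℝ) < d := by exact_mod_cast hd
  set γ := swapVec d with hγ
  have hγγ : star γ ⬝ᵥ γ = (d : ℂ) ^ 2 := swapVec_dotProduct_self
  rw [choi_swapChannel, ← hγ] at hB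
  -- If v ⟂ γ, the quadratic form vanishes at (v, 0), so positivity puts (v, 0) in the kernel of the
  -- whole block matrix.
  have hker : ∀ v, star γ ⬝ᵥ v = 0 → Q *ᵥ v = 0 := fun v hv => by
    have h := (hB.dotProduct_mulVec_zero_iff (Sum.elim v 0)).1 (by
      rw [Matrix.fromBlocks_mulVec]
      simp [Sum.elim_comp_inl, Sum.elim_comp_inr, Matrix.vecMulVec_mulVec, hv,
        Function.star_sumElim])
    rw [Matrix.fromBlocks_mulVec] at h
    ext i
    simpa using congrFun h (Sum.inr i)
  have hQγ : (d : ℂ) ^ 2 • Q = Matrix.vecMulVec (Q *ᵥ γ) (star γ) := by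
    ext i j
    have h := congrFun (hker ((d : ℂ) ^ 2 • Pi.single j 1 - star (γ j) • γ) (by
      rw [dotProduct_sub, dotProduct_smul, dotProduct_smul, hγγ, dotProduct_single_one,
        smul_eq_mul, smul_eq_mul, Pi.star_apply, mul_comm, sub_self])) i
    rw [Matrix.mulVec_sub, Matrix.mulVec_smul, Matrix.mulVec_smul, Matrix.mulVec_single_one] at h
    simp only [Pi.sub_apply, Pi.smul_apply, Pi.zero_apply, Matrix.col_apply, smul_eq_mul] at h
    rw [Matrix.smul_apply, smul_eq_mul, Matrix.vecMulVec_apply, Pi.star_apply,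
      sub_eq_zero.1 h, mul_comm]
  have htr : star γ ⬝ᵥ Q *ᵥ γ = (d : ℂ) ^ 2 * Q.trace := by
    rw [← smul_eq_mul, ← Matrix.trace_smul, hQγ, Matrix.trace_vecMulVec, dotProduct_comm]
  have hre : l * d ^ 2 ≤ Q.trace.re := by
    have h := (Complex.le_def.1 (Matrix.le_iff.1 hQ).trace_nonneg).1
    have h' : (traceSnd Q).trace = Q.trace := (Fintype.sum_prod_type fun x => Q x x).symm
    rw [Matrix.trace_sub, hermPart, Matrix.trace_smul, Matrix.trace_smul, Matrix.trace_add,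
      Matrix.trace_conjTranspose, h', Matrix.trace_one] at h
    simp at h
    nlinarith
  -- The test vector is (lγ, −γ); the scale l is the optimal one when Re⟨γ, Qγ⟩ = l d⁴.
  have hpos : 0 ≤ l ^ 2 * d ^ 4 - 2 * l * (star γ ⬝ᵥ Q *ᵥ γ).re +
      (star γ ⬝ᵥ choi M *ᵥ γ).re := by
    have h := (Complex.le_def.1 (hB.dotProduct_mulVec_nonneg
      (Sum.elim ((l : ℂ) • γ) (-γ)))).1
    have h' : star γ ⬝ᵥ Qᴴ *ᵥ γ = star (star γ ⬝ᵥ Q *ᵥ γ) := by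
      rw [Matrix.star_dotProduct, Matrix.star_mulVec, Matrix.conjTranspose_conjTranspose,
        ← Matrix.dotProduct_mulVec]
    rw [Matrix.fromBlocks_mulVec, Function.star_sumElim, sumElim_dotProduct_sumElim,
      Sum.elim_comp_inl, Sum.elim_comp_inr, star_smul, star_neg, Matrix.mulVec_smul,
      Matrix.mulVec_smul, Matrix.mulVec_neg, Matrix.mulVec_neg, Matrix.vecMulVec_mulVec, hγγ] at h
    simp only [smul_dotProduct, dotProduct_add, dotProduct_smul, neg_dotProduct, dotProduct_neg,
      hγγ, h', smul_eq_mul] at h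
    have hD : (d : ℂ) ^ 2 = (((d : ℝ) ^ 2 : ℝ) : ℂ) := by
      push_cast
      rfl
    rw [hD] at h
    simp only [op_smul_eq_mul, RCLike.star_def, Complex.conj_ofReal, Complex.add_re,
      Complex.neg_re, Complex.re_ofReal_mul, Complex.conj_re, ← Complex.ofReal_mul,
      Complex.ofReal_re, Complex.zero_re] at h
    linarith
  have hz : (star γ ⬝ᵥ Q *ᵥ γ).re = d ^ 2 * Q.trace.re := by
    rw [htr, ← Complex.re_ofReal_mul]
    push_cast
    rfl
  rw [swapEntFid, le_div_iff₀ (by positivity)]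
  have h5 : l * (l * d ^ 4) ≤ l * (d ^ 2 * Q.trace.re) := by
    refine mul_le_mul_of_nonneg_left ?_ hl
    nlinarith [sq_nonneg (d : ℝ)]
  rw [hz] at hpos
  linarith

theorem fromBlocks_zero_posSemidef {n : Type*} [Fintype n] {A : Matrix n n ℂ} (hA : A.PosSemidef) :
    (Matrix.fromBlocks 0 0 0 A : Matrix (n ⊕ n) (n ⊕ n) ℂ).PosSemidef := by
  classical
  have h := hA.conjTranspose_mul_mul_same (Matrix.fromCols (0 : Matrix n n ℂ) (1 : Matrix n n ℂ))
  convert h using 1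
  ext (i | i) (j | j) <;>
    simp [Matrix.mul_fromCols, Matrix.conjTranspose_fromCols_eq_fromRows_conjTranspose]

/-- The matrix is the rank-one projector onto (γ, √f γ), unnormalized, plus the Choi operator of R
in the lower corner. -/
theorem fromBlocks_posSemidef {f : ℝ} (hf : 0 ≤ f)
    {R : Superop (Fin d × Fin d) (Fin d × Fin d)} (hR : IsCP R) :
    (Matrix.fromBlocks (choi (swapChannel d)) ((√f : ℂ) • choi (swapChannel d))ᴴ
      ((√f : ℂ) • choi (swapChannel d)) (choi ((f : ℂ) • swapChannel d + R))).PosSemidef := by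
  set γ := swapVec d with hγ
  have hR' := isCP_iff_choi_posSemidef.1 hR
  have hsq : (√f : ℂ) * (√f : ℂ) = f := by
    rw [← Complex.ofReal_mul, Real.mul_self_sqrt hf]
  have h1 : choi ((f : ℂ) • swapChannel d + R) = (f : ℂ) • choi (swapChannel d) + choi R := rfl
  have h3 : Matrix.fromBlocks (choi (swapChannel d)) ((√f : ℂ) • choi (swapChannel d))ᴴ
      ((√f : ℂ) • choi (swapChannel d)) (choi ((f : ℂ) • swapChannel d + R)) =
      Matrix.vecMulVec (Sum.elim γ ((√f : ℂ) • γ)) (star (Sum.elim γ ((√f : ℂ) • γ))) +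
        Matrix.fromBlocks 0 0 0 (choi R) := by
    rw [h1, choi_swapChannel, ← hγ]
    ext (i | i) (j | j)
    · simp [Matrix.vecMulVec_apply]
    · simp [Matrix.vecMulVec_apply]
      ring
    · simp [Matrix.vecMulVec_apply]
      ring
    · simp [Matrix.vecMulVec_apply]
      rw [← hsq]
      ring
  rw [h3]
  exact (Matrix.posSemidef_vecMulVec_self_star _).add (fromBlocks_zero_posSemidef hR')

end BlockMatrix

/-! ### All three quantities from one set of attainable fidelities. -/

section Reduction

variable {E G : Type*} [Fintype E] [Fintype G] [DecidableEq E] [DecidableEq G] {d : ℕ}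

/-- `hmem` supplies the lower bounds on the errors and `hex` the matching upper bounds. No
compactness is needed: the suprema and infima are compared without being attained. -/
theorem swap_errors_eq (hd : 1 ≤ d) {ρ : Matrix (E × G) (E × G) ℂ} (hρ : IsState ρ) {F : Set ℝ}
    (hF : F.Nonempty) (hF01 : ∀ f ∈ F, 0 ≤ f ∧ f ≤ 1)
    (hmem : ∀ P : Superop ((Fin d × Fin d) × (E × G)) (Fin d × Fin d), IsCPPTP P →
      swapEntFid d (simulate P ρ) ∈ F)
    (hex : ∀ f ∈ F, ∃ P : Superop ((Fin d × Fin d) × (E × G)) (Fin d × Fin d), IsCPPTP P ∧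
      ∃ R, IsCP R ∧ simulate P ρ = (f : ℂ) • swapChannel d + R) :
    errPPTInfid (swapChannel d) ρ = 1 - sSup F ∧ errPPT (swapChannel d) ρ = 1 - sSup F ∧
      infidSDP (swapChannel d) ρ = 1 - sSup F := by
  have hbdd : BddAbove F := ⟨1, fun f hf => (hF01 f hf).2⟩
  have key : ∀ S : Set ℝ, (∀ x ∈ S, 1 - sSup F ≤ x) → (∀ f ∈ F, ∃ x ∈ S, x ≤ 1 - f) →
      sInf S = 1 - sSup F := fun S h1 h2 => by
    have hne : S.Nonempty := by
      obtain ⟨f, hf⟩ := hF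
      obtain ⟨x, hx, -⟩ := h2 f hf
      exact ⟨x, hx⟩
    refine le_antisymm ?_ (le_csInf hne h1)
    have : sSup F ≤ 1 - sInf S := by
      refine csSup_le hF fun f hf => ?_
      obtain ⟨x, hx, hxf⟩ := h2 f hf
      have := csInf_le ⟨_, h1⟩ hx
      linarith
    linarith
  refine ⟨key _ ?_ ?_, key _ ?_ ?_, ?_⟩
  · rintro x ⟨P, hP, rfl⟩
    have h1 := channelFidelity_swap_le hd (isChannel_simulate hP.1 hρ)
    have h2 := le_csSup hbdd (hmem P hP)
    linarith
  · intro f hf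
    obtain ⟨P, hP, R, hR, h⟩ := hex f hf
    have h1 := le_channelFidelity_swap hd (hF01 f hf).1 hR h
    exact ⟨_, ⟨P, hP, rfl⟩, by linarith⟩
  · rintro x ⟨P, hP, rfl⟩
    have h1 := le_diamondDist_swap hd (isChannel_simulate hP.1 hρ)
    have h2 := le_csSup hbdd (hmem P hP)
    linarith
  · intro f hf
    obtain ⟨P, hP, R, hR, h⟩ := hex f hf
    exact ⟨_, ⟨P, hP, rfl⟩, diamondDist_swap_le hd (hF01 f hf).2 (isChannel_simulate hP.1 hρ) hR h⟩
  · rw [infidSDP]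
    congr 1
    set S := {l : ℝ | _}
    have h1 : ∀ l ∈ S, 0 ≤ l ∧ l ^ 2 ≤ sSup F := by
      rintro l ⟨hl, P, Q, hP, hQ, hPT, htr, hB⟩
      have hPc : choi (ofChoi P) = P := choi_ofChoi P
      have hcp : IsCPPTP (ofChoi P) := (isCPPTP_iff _).2 (by rw [hPc]; exact ⟨hP, hPT, htr⟩)
      refine ⟨hl, (sq_le_of_fromBlocks_posSemidef hd hl hQ ?_).trans
        (le_csSup hbdd (hmem (ofChoi P) hcp))⟩
      rw [choi_simulate, hPc]
      exact Matrix.nonneg_iff_posSemidef.1 hB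
    have h2 : ∀ f ∈ F, √f ∈ S := fun f hf => by
      obtain ⟨P, hP, R, hR, h⟩ := hex f hf
      obtain ⟨hP1, hP2, hP3⟩ := (isCPPTP_iff P).1 hP
      -- With Q = √f Γ, the partial trace of Q is √f times the identity, so the constraint on λ
      -- holds with equality.
      refine ⟨Real.sqrt_nonneg f, choi P, (√f : ℂ) • choi (swapChannel d), hP1, ?_, hP2, hP3, ?_⟩
      · have h4 : hermPart (traceSnd ((√f : ℂ) • choi (swapChannel d))) =
            √f • (1 : Matrix (Fin d × Fin d) (Fin d × Fin d) ℂ) := by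
          have h5 : traceSnd ((√f : ℂ) • choi (swapChannel d)) =
              √f • (1 : Matrix (Fin d × Fin d) (Fin d × Fin d) ℂ) := by
            rw [← trace_preserving_iff.1 (isChannel_swapChannel (d := d)).2]
            ext i j
            simp [traceSnd, Finset.mul_sum]
          rw [h5, hermPart, Matrix.conjTranspose_smul, Matrix.conjTranspose_one, star_trivial]
          module
        exact h4.ge
      · rw [← choi_simulate, h]
        exact Matrix.nonneg_iff_posSemidef.2 (fromBlocks_posSemidef (hF01 f hf).1 hR)
    have hbS : BddAbove S := ⟨1, fun l hl => by
      have h3 := (h1 l hl).2.trans (csSup_le hF fun f hf => (hF01 f hf).2)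
      nlinarith [(h1 l hl).1]⟩
    obtain ⟨f₀, hf₀⟩ := hF
    have hS0 : 0 ≤ sSup S := (Real.sqrt_nonneg f₀).trans (le_csSup hbS (h2 f₀ hf₀))
    refine le_antisymm ?_ (csSup_le ⟨f₀, hf₀⟩ fun f hf => ?_)
    · have h3 : sSup S ≤ √(sSup F) := csSup_le ⟨_, h2 f₀ hf₀⟩ fun l hl =>
        Real.le_sqrt_of_sq_le (h1 l hl).2
      calc sSup S ^ 2 ≤ √(sSup F) ^ 2 := by gcongr
        _ = sSup F := Real.sq_sqrt ((hF01 f₀ hf₀).1.trans (le_csSup hbdd hf₀))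
    · calc f = √f ^ 2 := (Real.sq_sqrt (hF01 f hf).1).symm
        _ ≤ sSup S ^ 2 := by
          gcongr
          exact le_csSup hbS (h2 f hf)

end Reduction


/-! ### Products of operators on AB' and BA', and their partial transposes. -/

section Splice

variable {d : ℕ}

theorem posSemidef_of_isHermitian_of_mul_self {n : Type*} [Fintype n] {H : Matrix n n ℂ}
    (hH : H.IsHermitian) {c : ℝ} (hc : 0 < c) (h : H * H = (c : ℂ) • H) : H.PosSemidef := by
  have h1 : H = ((c⁻¹ : ℝ) : ℂ) • (H * Hᴴ) := by
    rw [hH.eq, h, smul_smul, ← Complex.ofReal_mul, inv_mul_cancel₀ hc.ne', Complex.ofReal_one,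
      one_smul]
  rw [h1]
  exact (Matrix.posSemidef_self_mul_conjTranspose H).smul
    (Complex.zero_le_real.2 (inv_nonneg.2 hc.le))

theorem maxEnt_apply (p q : Fin d × Fin d) :
    maxEnt (Fin d) p q = if p.1 = p.2 ∧ q.1 = q.2 then 1 else 0 := rfl

theorem maxEnt_mul_self : maxEnt (Fin d) * maxEnt (Fin d) = (d : ℂ) • maxEnt (Fin d) := by
  rw [maxEnt_eq_vecMulVec, Matrix.vecMulVec_mul_vecMulVec, Matrix.vecMulVec_smul]
  congr 1
  simp [dotProduct, Fintype.sum_prod_type]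

theorem swapOp_mul_self : swapOp d * swapOp d = 1 := by
  ext p q
  rw [swapOp_mul_apply, swapOp_apply, Matrix.one_apply]
  exact if_congr (by simp [Prod.ext_iff, and_comm]) rfl rfl

theorem swapOp_isHermitian : (swapOp d).IsHermitian := by
  ext p q
  rw [Matrix.conjTranspose_apply, swapOp_apply, swapOp_apply, apply_ite star, star_one, star_zero]
  exact if_congr (by tauto) rfl rfl

theorem maxEnt_compl_posSemidef (hd : 1 ≤ d) : ((d : ℂ) • 1 - maxEnt (Fin d)).PosSemidef := by
  refine posSemidef_of_isHermitian_of_mul_self ?_ (c := d) (by exact_mod_cast hd) ?_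
  · refine Matrix.IsHermitian.sub ?_ maxEnt_posSemidef.isHermitian
    rw [Matrix.IsHermitian, Matrix.conjTranspose_smul, Matrix.conjTranspose_one]
    simp
  · rw [Matrix.sub_mul, Matrix.mul_sub, Matrix.mul_sub, maxEnt_mul_self]
    simp only [Matrix.smul_mul, Matrix.mul_smul, Matrix.one_mul, Matrix.mul_one,
      Complex.ofReal_natCast]
    module

theorem one_add_swapOp_posSemidef : (1 + swapOp d).PosSemidef := by
  refine posSemidef_of_isHermitian_of_mul_self
    (Matrix.isHermitian_one.add swapOp_isHermitian) (c := 2) two_pos ?_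
  rw [Matrix.add_mul, Matrix.mul_add, Matrix.mul_add, swapOp_mul_self]
  simp only [Matrix.one_mul, Matrix.mul_one, Complex.ofReal_ofNat]
  module

theorem one_sub_swapOp_posSemidef : (1 - swapOp d).PosSemidef := by
  refine posSemidef_of_isHermitian_of_mul_self
    (Matrix.isHermitian_one.sub swapOp_isHermitian) (c := 2) two_pos ?_
  rw [Matrix.sub_mul, Matrix.mul_sub, Matrix.mul_sub, swapOp_mul_self]
  simp only [Matrix.one_mul, Matrix.mul_one, Complex.ofReal_ofNat]
  module

/-- The operator `x ⊗ y` on `A B A' B'`, with `x` acting on `A B'` and `y` acting on `B A'`. -/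
noncomputable def splice (x y : Matrix (Fin d × Fin d) (Fin d × Fin d) ℂ) :
    Matrix ((Fin d × Fin d) × (Fin d × Fin d)) ((Fin d × Fin d) × (Fin d × Fin d)) ℂ :=
  (x ⊗ₖ y).submatrix (fun p => ((p.1.1, p.2.2), (p.1.2, p.2.1)))
    (fun p => ((p.1.1, p.2.2), (p.1.2, p.2.1)))

theorem splice_apply (x y : Matrix (Fin d × Fin d) (Fin d × Fin d) ℂ)
    (p q : (Fin d × Fin d) × (Fin d × Fin d)) :
    splice x y p q = x (p.1.1, p.2.2) (q.1.1, q.2.2) * y (p.1.2, p.2.1) (q.1.2, q.2.1) := rfl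

theorem splice_posSemidef {x y : Matrix (Fin d × Fin d) (Fin d × Fin d) ℂ} (hx : x.PosSemidef)
    (hy : y.PosSemidef) : (splice x y).PosSemidef :=
  (hx.kronecker hy).submatrix _

theorem splice_maxEnt :
    splice (maxEnt (Fin d)) (maxEnt (Fin d)) = choi (swapChannel d) := by
  rw [choi_swapChannel, star_swapVec]
  ext ⟨⟨a, b⟩, ⟨a', b'⟩⟩ ⟨⟨c, e⟩, ⟨c', e'⟩⟩
  simp only [splice_apply, maxEnt_apply, Matrix.vecMulVec_apply, swapVec, Prod.swap_prod_mk,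
    Prod.mk.injEq, ite_and, mul_ite, mul_one, mul_zero]
  split_ifs <;> rfl

theorem splice_one : splice (1 : Matrix (Fin d × Fin d) (Fin d × Fin d) ℂ) 1 = 1 := by
  rw [splice, Matrix.one_kronecker_one, Matrix.submatrix_one]
  rintro ⟨⟨a, b⟩, ⟨a', b'⟩⟩ ⟨⟨c, e⟩, ⟨c', e'⟩⟩ h
  simp only [Prod.mk.injEq] at h ⊢
  tauto

/-- The transpose `T_{B B'}` on `A B A' B'`. -/
noncomputable def transposeBobOut (W : Matrix ((Fin d × Fin d) × (Fin d × Fin d))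
      ((Fin d × Fin d) × (Fin d × Fin d)) ℂ) :
    Matrix ((Fin d × Fin d) × (Fin d × Fin d)) ((Fin d × Fin d) × (Fin d × Fin d)) ℂ :=
  Matrix.of fun p q => W ((p.1.1, q.1.2), (p.2.1, q.2.2)) ((q.1.1, p.1.2), (q.2.1, p.2.2))

theorem transposeBobOut_transposeBobOut (W : Matrix ((Fin d × Fin d) × (Fin d × Fin d))
      ((Fin d × Fin d) × (Fin d × Fin d)) ℂ) : transposeBobOut (transposeBobOut W) = W := rfl

/-- Bob holds the second factor of AB' but the first factor of BA'; a transpose on the first factor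
is the full transpose of one on the second. -/
theorem transposeBobOut_splice (x y : Matrix (Fin d × Fin d) (Fin d × Fin d) ℂ) :
    transposeBobOut (splice x y) = splice (transposeSnd x) (transposeSnd y)ᵀ := rfl

theorem transposeSnd_one {m n : Type*} [DecidableEq m] [DecidableEq n] :
    transposeSnd (1 : Matrix (m × n) (m × n) ℂ) = 1 := by
  ext ⟨a, b⟩ ⟨c, e⟩
  change (1 : Matrix (m × n) (m × n) ℂ) (a, e) (c, b) = _
  rw [Matrix.one_apply, Matrix.one_apply]
  exact if_congr (by simp only [Prod.mk.injEq]; tauto) rfl rfl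

theorem transposeSnd_maxEnt : transposeSnd (maxEnt (Fin d)) = swapOp d := by
  ext ⟨a, b⟩ ⟨c, e⟩
  rw [swapOp_apply]
  exact if_congr (by simp only; tauto) rfl rfl

theorem swapOp_transpose : (swapOp d)ᵀ = swapOp d := by
  ext p q
  rw [Matrix.transpose_apply, swapOp_apply, swapOp_apply]
  exact if_congr (by tauto) rfl rfl

theorem transposeBobOut_splice_maxEnt (a b a' b' : ℂ) :
    transposeBobOut (splice (a • 1 + b • maxEnt (Fin d)) (a' • 1 + b' • maxEnt (Fin d))) =
      splice (a • 1 + b • swapOp d) (a' • 1 + b' • swapOp d) := by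
  simp only [transposeBobOut_splice, map_add, map_smul, transposeSnd_one, transposeSnd_maxEnt,
    Matrix.transpose_add, Matrix.transpose_smul, Matrix.transpose_one, swapOp_transpose]

end Splice

/-! ### Attaching operators on the resource, and contracting them out. -/

section Glue

variable {E G : Type*} {d : ℕ}

/-- The operator `W ⊗ Kᵀ` with the systems in the order `A B Â B̂ A' B'`. -/
noncomputable def glue
    (W : Matrix ((Fin d × Fin d) × (Fin d × Fin d)) ((Fin d × Fin d) × (Fin d × Fin d)) ℂ)
    (K : Matrix (E × G) (E × G) ℂ) :
    Matrix (((Fin d × Fin d) × (E × G)) × (Fin d × Fin d))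
      (((Fin d × Fin d) × (E × G)) × (Fin d × Fin d)) ℂ :=
  (W ⊗ₖ Kᵀ).submatrix (fun p => ((p.1.1, p.2), p.1.2)) (fun p => ((p.1.1, p.2), p.1.2))

theorem glue_apply
    (W : Matrix ((Fin d × Fin d) × (Fin d × Fin d)) ((Fin d × Fin d) × (Fin d × Fin d)) ℂ)
    (K : Matrix (E × G) (E × G) ℂ) (p q : ((Fin d × Fin d) × (E × G)) × (Fin d × Fin d)) :
    glue W K p q = W (p.1.1, p.2) (q.1.1, q.2) * K q.1.2 p.1.2 := rfl

theorem transposeBobChoi_glue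
    (W : Matrix ((Fin d × Fin d) × (Fin d × Fin d)) ((Fin d × Fin d) × (Fin d × Fin d)) ℂ)
    (K : Matrix (E × G) (E × G) ℂ) :
    transposeBobChoi (glue W K) = glue (transposeBobOut W) (transposeSnd K) := rfl

theorem traceSnd_glue_splice [DecidableEq E] [DecidableEq G]
    {x y : Matrix (Fin d × Fin d) (Fin d × Fin d) ℂ} {a b : ℂ}
    (hx : traceSnd x = a • 1) (hy : traceSnd y = b • 1) (K : Matrix (E × G) (E × G) ℂ) :
    traceSnd (glue (splice x y) K) = (a * b) • ((1 : Matrix (Fin d × Fin d) _ ℂ) ⊗ₖ Kᵀ) := by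
  ext ⟨⟨i, j⟩, l⟩ ⟨⟨i', j'⟩, h⟩
  have hx' : ∑ k, x (i, k) (i', k) = a * if i = i' then 1 else 0 := by
    rw [← Matrix.one_apply, ← smul_eq_mul, ← Matrix.smul_apply, ← hx]
    rfl
  have hy' : ∑ k, y (j, k) (j', k) = b * if j = j' then 1 else 0 := by
    rw [← Matrix.one_apply, ← smul_eq_mul, ← Matrix.smul_apply, ← hy]
    rfl
  simp only [traceSnd, Matrix.of_apply, glue_apply, splice_apply, Fintype.sum_prod_type,
    Matrix.smul_apply, Matrix.kronecker_apply, Matrix.transpose_apply, ← Finset.sum_mul,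
    ← Finset.mul_sum, hx', hy', Matrix.one_apply, Prod.mk.injEq, ite_and, smul_eq_mul]
  split_ifs <;> ring

variable [Fintype E] [Fintype G]

theorem glue_posSemidef
    {W : Matrix ((Fin d × Fin d) × (Fin d × Fin d)) ((Fin d × Fin d) × (Fin d × Fin d)) ℂ}
    {K : Matrix (E × G) (E × G) ℂ} (hW : W.PosSemidef) (hK : K.PosSemidef) :
    (glue W K).PosSemidef := by
  classical
  exact (hW.kronecker hK.transpose).submatrix _

theorem contractResource_glue (ρ : Matrix (E × G) (E × G) ℂ)
    (W : Matrix ((Fin d × Fin d) × (Fin d × Fin d)) ((Fin d × Fin d) × (Fin d × Fin d)) ℂ)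
    (K : Matrix (E × G) (E × G) ℂ) :
    contractResource ρ (glue W K) = (ρ * K).trace • W := by
  ext p q
  simp only [contractResource, Matrix.of_apply, glue_apply, Matrix.transpose_apply, Matrix.trace,
    Matrix.diag_apply, Matrix.mul_apply, Matrix.smul_apply, smul_eq_mul, Finset.sum_mul]
  rw [Finset.sum_comm]
  exact Finset.sum_congr rfl fun l _ => Finset.sum_congr rfl fun h _ => by ring

theorem contractResource_add (ρ : Matrix (E × G) (E × G) ℂ)
    (P P' : Matrix (((Fin d × Fin d) × (E × G)) × (Fin d × Fin d))
      (((Fin d × Fin d) × (E × G)) × (Fin d × Fin d)) ℂ) :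
    contractResource ρ (P + P') = contractResource ρ P + contractResource ρ P' := by
  ext p q
  simp only [contractResource, Matrix.of_apply, Matrix.add_apply, mul_add, Finset.sum_add_distrib]

/-- The operator on the resource systems obtained by contracting the systems `A B A' B'` of `P`
with `W`, transposed. -/
noncomputable def contractSwap (P : Matrix (((Fin d × Fin d) × (E × G)) × (Fin d × Fin d))
      (((Fin d × Fin d) × (E × G)) × (Fin d × Fin d)) ℂ)
    (W : Matrix ((Fin d × Fin d) × (Fin d × Fin d)) ((Fin d × Fin d) × (Fin d × Fin d)) ℂ) :
    Matrix (E × G) (E × G) ℂ :=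
  Matrix.of fun h l => ∑ p, ∑ q, W q p * P ((p.1, l), p.2) ((q.1, h), q.2)

section ContractSwap

variable {P : Matrix (((Fin d × Fin d) × (E × G)) × (Fin d × Fin d))
  (((Fin d × Fin d) × (E × G)) × (Fin d × Fin d)) ℂ}
  {W : Matrix ((Fin d × Fin d) × (Fin d × Fin d)) ((Fin d × Fin d) × (Fin d × Fin d)) ℂ}

/-- Up to transposes, this applies to W the completely positive map whose Choi operator is P with
its systems reordered. -/
theorem contractSwap_posSemidef (hP : P.PosSemidef) (hW : W.PosSemidef) :
    (contractSwap P W).PosSemidef :=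
  (ofChoi_posSemidef (hP.submatrix fun x : ((Fin d × Fin d) × (Fin d × Fin d)) × (E × G) =>
    ((x.1.1, x.2), x.1.2)) hW.transpose).transpose

omit [Fintype E] [Fintype G] in
theorem contractSwap_add (P : Matrix (((Fin d × Fin d) × (E × G)) × (Fin d × Fin d))
      (((Fin d × Fin d) × (E × G)) × (Fin d × Fin d)) ℂ)
    (W W' : Matrix ((Fin d × Fin d) × (Fin d × Fin d)) ((Fin d × Fin d) × (Fin d × Fin d)) ℂ) :
    contractSwap P (W + W') = contractSwap P W + contractSwap P W' := by
  ext h l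
  simp only [contractSwap, Matrix.of_apply, Matrix.add_apply, add_mul, Finset.sum_add_distrib]

omit [Fintype E] [Fintype G] in
theorem contractSwap_smul (P : Matrix (((Fin d × Fin d) × (E × G)) × (Fin d × Fin d))
      (((Fin d × Fin d) × (E × G)) × (Fin d × Fin d)) ℂ) (c : ℂ)
    (W : Matrix ((Fin d × Fin d) × (Fin d × Fin d)) ((Fin d × Fin d) × (Fin d × Fin d)) ℂ) :
    contractSwap P (c • W) = c • contractSwap P W := by
  ext h l
  simp only [contractSwap, Matrix.of_apply, Matrix.smul_apply, smul_eq_mul, mul_assoc,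
    Finset.mul_sum]

omit [Fintype E] [Fintype G] in
theorem contractSwap_one [DecidableEq E] [DecidableEq G] (htr : traceSnd P = 1) :
    contractSwap P 1 = ((d : ℂ) ^ 2) • 1 := by
  ext h l
  have h1 : ∀ p : Fin d × Fin d, ∑ k, P ((p, l), k) ((p, h), k) = if h = l then 1 else 0 :=
    fun p => by
      have h2 := congrFun (congrFun htr (p, l)) (p, h)
      rw [Matrix.one_apply] at h2
      refine Eq.trans h2 (if_congr ?_ rfl rfl)
      simp [eq_comm]
  simp only [contractSwap, Matrix.of_apply, Matrix.one_apply, ite_mul, one_mul, zero_mul,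
    Finset.sum_ite_eq', Finset.mem_univ, if_true, Fintype.sum_prod_type
      (f := fun p : (Fin d × Fin d) × (Fin d × Fin d) => P ((p.1, l), p.2) ((p.1, h), p.2)), h1,
    Matrix.smul_apply, smul_eq_mul]
  simp [sq]

omit [Fintype E] [Fintype G] in
-- Partial transposition is self-adjoint for the trace pairing: the involution `e` swaps Bob's row
-- and column indices in the double sum.
theorem transposeSnd_contractSwap :
    transposeSnd (contractSwap P (transposeBobOut W)) = contractSwap (transposeBobChoi P) W := by
  ext ⟨h₁, h₂⟩ ⟨l₁, l₂⟩
  change ∑ p, ∑ q, transposeBobOut W q p * P ((p.1, (l₁, h₂)), p.2) ((q.1, (h₁, l₂)), q.2) =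
    ∑ p, ∑ q, W q p * transposeBobChoi P ((p.1, (l₁, l₂)), p.2) ((q.1, (h₁, h₂)), q.2)
  rw [← Fintype.sum_prod_type', ← Fintype.sum_prod_type']
  let e : ((Fin d × Fin d) × (Fin d × Fin d)) × ((Fin d × Fin d) × (Fin d × Fin d)) ≃
      ((Fin d × Fin d) × (Fin d × Fin d)) × ((Fin d × Fin d) × (Fin d × Fin d)) :=
    { toFun := fun x => (((x.1.1.1, x.2.1.2), (x.1.2.1, x.2.2.2)),
        ((x.2.1.1, x.1.1.2), (x.2.2.1, x.1.2.2)))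
      invFun := fun x => (((x.1.1.1, x.2.1.2), (x.1.2.1, x.2.2.2)),
        ((x.2.1.1, x.1.1.2), (x.2.2.1, x.1.2.2)))
      left_inv := fun _ => rfl
      right_inv := fun _ => rfl }
  exact e.sum_comp fun x => W x.2 x.1 *
    transposeBobChoi P ((x.1.1, (l₁, l₂)), x.1.2) ((x.2.1, (h₁, h₂)), x.2.2)

/-- Both sides contract P completely with ρ and W. For W = Γ ⊗ Γ this identifies the entanglement
fidelity of the simulation with Tr[ρK]. -/
theorem trace_mul_contractSwap (ρ : Matrix (E × G) (E × G) ℂ)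
    (P : Matrix (((Fin d × Fin d) × (E × G)) × (Fin d × Fin d))
      (((Fin d × Fin d) × (E × G)) × (Fin d × Fin d)) ℂ)
    (W : Matrix ((Fin d × Fin d) × (Fin d × Fin d)) ((Fin d × Fin d) × (Fin d × Fin d)) ℂ) :
    (ρ * contractSwap P W).trace = (W * contractResource ρ P).trace := by
  have h1 : (ρ * contractSwap P W).trace = ∑ l, ∑ h, ∑ p, ∑ q,
      ρ l h * (W q p * P ((p.1, l), p.2) ((q.1, h), q.2)) := by
    simp only [Matrix.trace, Matrix.diag_apply, Matrix.mul_apply, contractSwap, Matrix.of_apply,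
      Finset.mul_sum]
  have h2 : (W * contractResource ρ P).trace = ∑ q, ∑ p, ∑ h, ∑ l,
      ρ l h * (W q p * P ((p.1, l), p.2) ((q.1, h), q.2)) := by
    simp only [Matrix.trace, Matrix.diag_apply, Matrix.mul_apply, contractResource, Matrix.of_apply,
      Finset.mul_sum, Matrix.transpose_apply]
    refine Finset.sum_congr rfl fun q _ => Finset.sum_congr rfl fun p _ =>
      Finset.sum_congr rfl fun h _ => Finset.sum_congr rfl fun l _ => by ring
  rw [h1, h2, Finset.sum_comm]
  refine (Finset.sum_congr rfl fun h _ => Finset.sum_congr rfl fun l _ => Finset.sum_comm).trans ?_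
  refine (Finset.sum_congr rfl fun h _ => Finset.sum_comm).trans (Finset.sum_comm.trans ?_)
  refine Finset.sum_congr rfl fun q _ => ?_
  exact (Finset.sum_congr rfl fun h _ => Finset.sum_comm).trans Finset.sum_comm

end ContractSwap

end Glue


/-! ### The reduced program for d ≥ 2. -/

section SwapReduction

variable {E G : Type*} [Fintype E] [Fintype G] [DecidableEq E] [DecidableEq G] {d : ℕ}

omit [Fintype E] [Fintype G] [DecidableEq E] [DecidableEq G] in
theorem transposeSnd_apply (X : Matrix (E × G) (E × G) ℂ) (p q : E × G) :
    transposeSnd X p q = X (p.1, q.2) (q.1, p.2) := rfl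

omit [Fintype E] [Fintype G] [DecidableEq E] [DecidableEq G] in
-- Each factor expands as d(1 + sΓ) = (d − Γ) + (1 + sd)Γ.
theorem contractSwap_splice (s t : ℂ)
    (P : Matrix (((Fin d × Fin d) × (E × G)) × (Fin d × Fin d))
      (((Fin d × Fin d) × (E × G)) × (Fin d × Fin d)) ℂ) :
    (d : ℂ) ^ 2 • contractSwap P
      (splice ((1 : ℂ) • 1 + s • maxEnt (Fin d)) ((1 : ℂ) • 1 + t • maxEnt (Fin d))) =
      contractSwap P (splice ((d : ℂ) • 1 - maxEnt (Fin d)) ((d : ℂ) • 1 - maxEnt (Fin d))) +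
      (1 + s * d) • contractSwap P (splice (maxEnt (Fin d)) ((d : ℂ) • 1 - maxEnt (Fin d))) +
      (1 + t * d) • contractSwap P (splice ((d : ℂ) • 1 - maxEnt (Fin d)) (maxEnt (Fin d))) +
      ((1 + s * d) * (1 + t * d)) • contractSwap P (splice (maxEnt (Fin d)) (maxEnt (Fin d))) := by
  simp only [← contractSwap_smul, ← contractSwap_add]
  congr 1
  ext p q
  simp only [splice_apply, Matrix.add_apply, Matrix.sub_apply, Matrix.smul_apply, smul_eq_mul]
  ring

/-- Each operator inequality is the positivity of the partially transposed P contracted with (1 ±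
swap) ⊗ (1 ± swap), rewritten through `contractSwap_splice` with s, t = ±1. The factor d⁻⁴ makes the
four operators sum to the identity. -/
theorem swapFeasible_of_choi (hd : 2 ≤ d)
    {P : Matrix (((Fin d × Fin d) × (E × G)) × (Fin d × Fin d))
      (((Fin d × Fin d) × (E × G)) × (Fin d × Fin d)) ℂ}
    (hP : P.PosSemidef) (hT : (transposeBobChoi P).PosSemidef) (htr : traceSnd P = 1) :
    SwapFeasible d
      (((d : ℂ) ^ 4)⁻¹ • contractSwap P (splice (maxEnt (Fin d)) (maxEnt (Fin d))))
      (((d : ℂ) ^ 4)⁻¹ • contractSwap P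
        (splice (maxEnt (Fin d)) ((d : ℂ) • 1 - maxEnt (Fin d))))
      (((d : ℂ) ^ 4)⁻¹ • contractSwap P
        (splice ((d : ℂ) • 1 - maxEnt (Fin d)) (maxEnt (Fin d))))
      (((d : ℂ) ^ 4)⁻¹ • contractSwap P
        (splice ((d : ℂ) • 1 - maxEnt (Fin d)) ((d : ℂ) • 1 - maxEnt (Fin d)))) := by
  have hd1 : 1 ≤ d := by omega
  have hdr : (2 : ℝ) ≤ d := by exact_mod_cast hd
  have hd0 : (d : ℂ) ≠ 0 := by exact_mod_cast (by omega : d ≠ 0)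
  have hdm : (d : ℂ) - 1 ≠ 0 := by
    rw [sub_ne_zero]
    exact_mod_cast (by omega : d ≠ 1)
  have hdp : (d : ℂ) + 1 ≠ 0 := by exact_mod_cast (by omega : d + 1 ≠ 0)
  have hΓ : (maxEnt (Fin d)).PosSemidef := maxEnt_posSemidef
  have hΓ' := maxEnt_compl_posSemidef hd1
  have hc : (0 : ℂ) ≤ ((d : ℂ) ^ 4)⁻¹ := by
    have : (0 : ℝ) ≤ ((d : ℝ) ^ 4)⁻¹ := by positivity
    have h := Complex.zero_le_real.2 this
    push_cast at h
    exact h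
  have hpt : ∀ {s t : ℂ}, ((1 : ℂ) • 1 + s • swapOp d).PosSemidef →
      ((1 : ℂ) • 1 + t • swapOp d).PosSemidef → ∀ {c : ℝ}, 0 ≤ c →
      0 ≤ ((((c / d ^ 2 : ℝ)) : ℂ) • transposeSnd (contractSwap P (splice
        ((1 : ℂ) • 1 + s • maxEnt (Fin d)) ((1 : ℂ) • 1 + t • maxEnt (Fin d))))) := by
    intro s t hs ht c hc
    refine Matrix.nonneg_iff_posSemidef.2
      (Matrix.PosSemidef.smul ?_ (Complex.zero_le_real.2 (by positivity)))
    rw [← transposeBobOut_transposeBobOut (splice _ _), transposeSnd_contractSwap,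
      transposeBobOut_splice_maxEnt]
    exact contractSwap_posSemidef hT (splice_posSemidef hs ht)
  have h1 : ((1 : ℂ) • 1 + (1 : ℂ) • swapOp d).PosSemidef := by
    simpa using one_add_swapOp_posSemidef (d := d)
  have h2 : ((1 : ℂ) • 1 + (-1 : ℂ) • swapOp d).PosSemidef := by
    simpa [sub_eq_add_neg] using one_sub_swapOp_posSemidef (d := d)
  have hK := (contractSwap_posSemidef hP (splice_posSemidef hΓ hΓ)).smul hc
  have hL := (contractSwap_posSemidef hP (splice_posSemidef hΓ hΓ')).smul hc
  have hM := (contractSwap_posSemidef hP (splice_posSemidef hΓ' hΓ)).smul hc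
  have hN := (contractSwap_posSemidef hP (splice_posSemidef hΓ' hΓ')).smul hc
  set k := contractSwap P (splice (maxEnt (Fin d)) (maxEnt (Fin d)))
  set l := contractSwap P (splice (maxEnt (Fin d)) ((d : ℂ) • 1 - maxEnt (Fin d)))
  set m := contractSwap P (splice ((d : ℂ) • 1 - maxEnt (Fin d)) (maxEnt (Fin d)))
  set n := contractSwap P (splice ((d : ℂ) • 1 - maxEnt (Fin d))
    ((d : ℂ) • 1 - maxEnt (Fin d)))
  have key : ∀ s t : ℂ, contractSwap P
      (splice ((1 : ℂ) • 1 + s • maxEnt (Fin d)) ((1 : ℂ) • 1 + t • maxEnt (Fin d))) =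
      ((d : ℂ) ^ 2)⁻¹ • (n + (1 + s * d) • l + (1 + t * d) • m +
        ((1 + s * d) * (1 + t * d)) • k) := fun s t => by
    rw [← contractSwap_splice s t P, smul_smul, inv_mul_cancel₀ (pow_ne_zero 2 hd0)]
    exact (one_smul ℂ _).symm
  -- At s = t = 0 the contraction is against the identity, which trace preservation evaluates to d².
  have hsum := key 0 0
  simp only [one_smul, zero_smul, zero_mul, mul_one, add_zero, splice_one,
    contractSwap_one htr] at hsum
  simp only [key] at hpt
  refine ⟨Matrix.nonneg_iff_posSemidef.2 hK, Matrix.nonneg_iff_posSemidef.2 hL,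
    Matrix.nonneg_iff_posSemidef.2 hM, Matrix.nonneg_iff_posSemidef.2 hN,
    ?_, sub_nonneg.1 ?_, sub_nonneg.1 ?_, sub_nonneg.1 ?_, ?_⟩
  -- In each case c is the inverse modulus of the coefficient (1 + sd)(1 + td) of K, so K enters
  -- with coefficient ±1.
  · refine (hpt h1 h1 (c := 1 / (d + 1) ^ 2) (by positivity)).trans_eq ?_
    ext p q
    simp only [transposeSnd_apply, Matrix.add_apply, Matrix.smul_apply, Complex.real_smul,
      smul_eq_mul]
    push_cast
    field_simp
    ring
  · refine (hpt h1 h2 (c := 1 / ((d - 1) * (d + 1)))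
      (one_div_nonneg.2 (mul_nonneg (by linarith) (by linarith)))).trans_eq ?_
    ext p q
    simp only [transposeSnd_apply, Matrix.add_apply, Matrix.sub_apply, Matrix.smul_apply,
      Complex.real_smul, smul_eq_mul]
    push_cast
    field_simp
    ring
  · refine (hpt h2 h1 (c := 1 / ((d - 1) * (d + 1)))
      (one_div_nonneg.2 (mul_nonneg (by linarith) (by linarith)))).trans_eq ?_
    ext p q
    simp only [transposeSnd_apply, Matrix.add_apply, Matrix.sub_apply, Matrix.smul_apply,
      Complex.real_smul, smul_eq_mul]
    push_cast
    field_simp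
    ring
  · refine (hpt h2 h2 (c := 1 / (d - 1) ^ 2) (by positivity)).trans_eq ?_
    ext p q
    simp only [transposeSnd_apply, Matrix.add_apply, Matrix.sub_apply, Matrix.smul_apply,
      Complex.real_smul, smul_eq_mul]
    push_cast
    field_simp
    ring
  · calc ((d : ℂ) ^ 4)⁻¹ • k + ((d : ℂ) ^ 4)⁻¹ • l + ((d : ℂ) ^ 4)⁻¹ • m + ((d : ℂ) ^ 4)⁻¹ • n
        = ((d : ℂ) ^ 2)⁻¹ • ((d : ℂ) ^ 2)⁻¹ • (n + l + m + k) := by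
          rw [show ((d : ℂ) ^ 4)⁻¹ = ((d : ℂ) ^ 2)⁻¹ * ((d : ℂ) ^ 2)⁻¹ by
            rw [← mul_inv, ← pow_add]]
          module
      _ = 1 := by
          rw [← hsum, smul_smul, inv_mul_cancel₀ (pow_ne_zero 2 hd0), one_smul]

theorem swapEntFid_simulate (P : Superop ((Fin d × Fin d) × (E × G)) (Fin d × Fin d))
    (ρ : Matrix (E × G) (E × G) ℂ) : swapEntFid d (simulate P ρ) = (ρ * (((d : ℂ) ^ 4)⁻¹ •
      contractSwap (choi P) (splice (maxEnt (Fin d)) (maxEnt (Fin d))))).trace.re := by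
  have h : ((d : ℂ) ^ 4)⁻¹ = ((((d : ℝ) ^ 4)⁻¹ : ℝ) : ℂ) := by
    push_cast
    rfl
  rw [Matrix.mul_smul, Matrix.trace_smul, trace_mul_contractSwap, splice_maxEnt, choi_swapChannel,
    Matrix.vecMulVec_mul, Matrix.trace_vecMulVec, dotProduct_comm, ← Matrix.dotProduct_mulVec,
    smul_eq_mul, h, Complex.re_ofReal_mul, swapEntFid, choi_simulate, div_eq_inv_mul]


/-- The part of `swapChoi` that does not act as the swap channel. -/
noncomputable def swapChoiRest (d : ℕ) (L M N : Matrix (E × G) (E × G) ℂ) :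
    Matrix (((Fin d × Fin d) × (E × G)) × (Fin d × Fin d))
      (((Fin d × Fin d) × (E × G)) × (Fin d × Fin d)) ℂ :=
  glue (splice (maxEnt (Fin d)) ((d : ℂ) • 1 - maxEnt (Fin d)))
      (((1 / (d ^ 2 - 1) : ℝ) : ℂ) • L) +
    glue (splice ((d : ℂ) • 1 - maxEnt (Fin d)) (maxEnt (Fin d)))
      (((1 / (d ^ 2 - 1) : ℝ) : ℂ) • M) +
    glue (splice ((d : ℂ) • 1 - maxEnt (Fin d)) ((d : ℂ) • 1 - maxEnt (Fin d)))
      (((1 / (d ^ 2 - 1) ^ 2 : ℝ) : ℂ) • N)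

/-- The Choi operator of the simulation channel given by a feasible point. -/
noncomputable def swapChoi (d : ℕ) (K L M N : Matrix (E × G) (E × G) ℂ) :
    Matrix (((Fin d × Fin d) × (E × G)) × (Fin d × Fin d))
      (((Fin d × Fin d) × (E × G)) × (Fin d × Fin d)) ℂ :=
  glue (splice (maxEnt (Fin d)) (maxEnt (Fin d))) K + swapChoiRest d L M N

theorem traceSnd_maxEnt : traceSnd (maxEnt (Fin d)) = (1 : ℂ) • 1 := by
  ext i j
  simp [traceSnd, maxEnt, ite_and, Matrix.one_apply, eq_comm]

theorem traceSnd_maxEnt_compl :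
    traceSnd ((d : ℂ) • 1 - maxEnt (Fin d)) = ((d : ℂ) ^ 2 - 1) • 1 := by
  have h : traceSnd ((d : ℂ) • 1 - maxEnt (Fin d)) =
      (d : ℂ) • traceSnd (1 : Matrix (Fin d × Fin d) (Fin d × Fin d) ℂ) -
        traceSnd (maxEnt (Fin d)) := by
    ext i j
    simp [traceSnd, Finset.mul_sum]
  have h' : traceSnd (1 : Matrix (Fin d × Fin d) (Fin d × Fin d) ℂ) = (d : ℂ) • 1 := by
    ext i j
    simp [traceSnd, Matrix.one_apply]
  rw [h, traceSnd_maxEnt, h']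
  module

omit [DecidableEq E] [DecidableEq G] in
theorem swapChoiRest_posSemidef (hd : 2 ≤ d) {L M N : Matrix (E × G) (E × G) ℂ}
    (hL : 0 ≤ L) (hM : 0 ≤ M) (hN : 0 ≤ N) : (swapChoiRest d L M N).PosSemidef := by
  have hdr : (2 : ℝ) ≤ d := by exact_mod_cast hd
  have hdr2 : (0 : ℝ) ≤ (d : ℝ) ^ 2 - 1 := by nlinarith
  have hΓ : (maxEnt (Fin d)).PosSemidef := maxEnt_posSemidef
  have hΓ' := maxEnt_compl_posSemidef (by omega : 1 ≤ d)
  refine (Matrix.PosSemidef.add ?_ ?_).add ?_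
  · exact glue_posSemidef (splice_posSemidef hΓ hΓ') ((Matrix.nonneg_iff_posSemidef.1 hL).smul
      (Complex.zero_le_real.2 (by positivity)))
  · exact glue_posSemidef (splice_posSemidef hΓ' hΓ) ((Matrix.nonneg_iff_posSemidef.1 hM).smul
      (Complex.zero_le_real.2 (by positivity)))
  · exact glue_posSemidef (splice_posSemidef hΓ' hΓ') ((Matrix.nonneg_iff_posSemidef.1 hN).smul
      (Complex.zero_le_real.2 (by positivity)))

omit [Fintype E] [Fintype G] [DecidableEq E] [DecidableEq G] in
theorem transposeBobChoi_add (X Y : Matrix (((Fin d × Fin d) × (E × G)) × (Fin d × Fin d))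
      (((Fin d × Fin d) × (E × G)) × (Fin d × Fin d)) ℂ) :
    transposeBobChoi (X + Y) = transposeBobChoi X + transposeBobChoi Y := rfl

theorem traceSnd_add {m n : Type*} [Fintype n] (X Y : Matrix (m × n) (m × n) ℂ) :
    traceSnd (X + Y) = traceSnd X + traceSnd Y := by
  ext i j
  simp [traceSnd, Finset.sum_add_distrib]

omit [Fintype E] [Fintype G] [DecidableEq E] [DecidableEq G] in
-- With V the swap operator, Γ becomes V = ½((1 + V) − (1 − V)), and d − Γ becomes d − V = ½((d −
-- 1)(1 + V) + (d + 1)(1 − V)). Expanding both factors produces the slacks of the reduced program;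
-- the two halves give 1/4.
theorem transposeBobChoi_swapChoi (hd : 2 ≤ d) (K L M N : Matrix (E × G) (E × G) ℂ) :
    transposeBobChoi (swapChoi d K L M N) = (((1 / 4 : ℝ)) : ℂ) •
      (glue (splice (1 + swapOp d) (1 + swapOp d)) (transposeSnd (K + (1 / (d + 1) : ℝ) • L +
        (1 / (d + 1) : ℝ) • M + (1 / (d + 1) ^ 2 : ℝ) • N)) +
      glue (splice (1 + swapOp d) (1 - swapOp d))
        ((1 / (d - 1) : ℝ) • transposeSnd (L + (1 / (d + 1) : ℝ) • N) -
          transposeSnd (K + (1 / (d + 1) : ℝ) • M)) +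
      glue (splice (1 - swapOp d) (1 + swapOp d))
        ((1 / (d - 1) : ℝ) • transposeSnd (M + (1 / (d + 1) : ℝ) • N) -
          transposeSnd (K + (1 / (d + 1) : ℝ) • L)) +
      glue (splice (1 - swapOp d) (1 - swapOp d))
        (transposeSnd (K + (1 / (d - 1) ^ 2 : ℝ) • N) -
          (1 / (d - 1) : ℝ) • transposeSnd (L + M))) := by
  have hdm : (d : ℂ) - 1 ≠ 0 := by
    rw [sub_ne_zero]
    exact_mod_cast (by omega : d ≠ 1)
  have hdp : (d : ℂ) + 1 ≠ 0 := by exact_mod_cast (by omega : d + 1 ≠ 0)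
  have hd2 : (d : ℂ) ^ 2 - 1 = (d - 1) * (d + 1) := by ring
  simp only [swapChoi, swapChoiRest, transposeBobChoi_add, transposeBobChoi_glue,
    transposeBobOut_splice, map_sub, map_smul, transposeSnd_one, transposeSnd_maxEnt,
    Matrix.transpose_sub, Matrix.transpose_smul, Matrix.transpose_one, swapOp_transpose]
  ext p q
  simp only [glue_apply, splice_apply, Matrix.add_apply, Matrix.sub_apply, Matrix.smul_apply,
    transposeSnd_apply, Complex.real_smul, smul_eq_mul]
  push_cast
  rw [hd2]
  field_simp
  ring

omit [Fintype E] [Fintype G] in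
-- Tracing out the output sends Γ to 1 and d − Γ to d² − 1, which cancels the weights in
-- `swapChoiRest`.
theorem traceSnd_swapChoi (hd : 2 ≤ d) {K L M N : Matrix (E × G) (E × G) ℂ}
    (hsum : K + L + M + N = 1) : traceSnd (swapChoi d K L M N) = 1 := by
  have hd2 : (d : ℂ) ^ 2 - 1 ≠ 0 := by
    rw [show (d : ℂ) ^ 2 - 1 = (d - 1) * (d + 1) by ring]
    refine mul_ne_zero ?_ (by exact_mod_cast (by omega : d + 1 ≠ 0))
    rw [sub_ne_zero]
    exact_mod_cast (by omega : d ≠ 1)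
  have h : traceSnd (swapChoi d K L M N) =
      (1 : Matrix (Fin d × Fin d) (Fin d × Fin d) ℂ) ⊗ₖ (K + L + M + N)ᵀ := by
    simp only [swapChoi, swapChoiRest, traceSnd_add,
      traceSnd_glue_splice traceSnd_maxEnt traceSnd_maxEnt,
      traceSnd_glue_splice traceSnd_maxEnt traceSnd_maxEnt_compl,
      traceSnd_glue_splice traceSnd_maxEnt_compl traceSnd_maxEnt,
      traceSnd_glue_splice traceSnd_maxEnt_compl traceSnd_maxEnt_compl]
    ext ⟨i, l⟩ ⟨j, h⟩
    simp only [Matrix.add_apply, Matrix.smul_apply, Matrix.kronecker_apply, Matrix.transpose_apply,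
      smul_eq_mul]
    push_cast
    field_simp
    ring
  rw [h, hsum, Matrix.transpose_one, Matrix.one_kronecker_one]

theorem swapChoi_feasible (hd : 2 ≤ d) {K L M N : Matrix (E × G) (E × G) ℂ}
    (h : SwapFeasible d K L M N) :
    0 ≤ swapChoi d K L M N ∧ 0 ≤ transposeBobChoi (swapChoi d K L M N) ∧
      traceSnd (swapChoi d K L M N) = 1 := by
  obtain ⟨hK, hL, hM, hN, h1, h2, h3, h4, hsum⟩ := h
  have hΓ : (maxEnt (Fin d)).PosSemidef := maxEnt_posSemidef
  have hp := one_add_swapOp_posSemidef (d := d)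
  have hm := one_sub_swapOp_posSemidef (d := d)
  refine ⟨Matrix.nonneg_iff_posSemidef.2 ?_, Matrix.nonneg_iff_posSemidef.2 ?_,
    traceSnd_swapChoi hd hsum⟩
  · exact (glue_posSemidef (splice_posSemidef hΓ hΓ) (Matrix.nonneg_iff_posSemidef.1 hK)).add
      (swapChoiRest_posSemidef hd hL hM hN)
  · rw [transposeBobChoi_swapChoi hd]
    refine Matrix.PosSemidef.smul ?_ (Complex.zero_le_real.2 (by norm_num))
    refine ((Matrix.PosSemidef.add ?_ ?_).add ?_).add ?_
    · exact glue_posSemidef (splice_posSemidef hp hp) (Matrix.nonneg_iff_posSemidef.1 h1)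
    · exact glue_posSemidef (splice_posSemidef hp hm) (Matrix.le_iff.1 h2)
    · exact glue_posSemidef (splice_posSemidef hm hp) (Matrix.le_iff.1 h3)
    · exact glue_posSemidef (splice_posSemidef hm hm) (Matrix.le_iff.1 h4)

theorem exists_simulate_eq_of_feasible (hd : 2 ≤ d) {K L M N : Matrix (E × G) (E × G) ℂ}
    (h : SwapFeasible d K L M N) {ρ : Matrix (E × G) (E × G) ℂ} (hρ : IsState ρ) :
    ∃ P : Superop ((Fin d × Fin d) × (E × G)) (Fin d × Fin d), IsCPPTP P ∧
      ∃ R, IsCP R ∧ simulate P ρ = ((ρ * K).trace.re : ℂ) • swapChannel d + R := by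
  refine ⟨ofChoi (swapChoi d K L M N), ?_,
    ofChoi (contractResource ρ (swapChoiRest d L M N)), ?_, ?_⟩
  · rw [isCPPTP_iff, choi_ofChoi]
    exact swapChoi_feasible hd h
  · rw [isCP_iff_choi_posSemidef, choi_ofChoi]
    exact contractResource_posSemidef hρ.1 (swapChoiRest_posSemidef hd h.2.1 h.2.2.1 h.2.2.2.1)
  -- The trace of a product of positive operators is real, so nothing is lost by taking its real
  -- part.
  · have htr : ((ρ * K).trace.re : ℂ) = (ρ * K).trace :=
      (Complex.eq_re_of_ofReal_le
        (trace_mul_nonneg hρ.1 (Matrix.nonneg_iff_posSemidef.1 h.1))).symm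
    apply choi_injective
    rw [show ∀ (c : ℂ) (S R : Superop (Fin d × Fin d) (Fin d × Fin d)),
      choi (c • S + R) = c • choi S + choi R from fun _ _ _ => rfl, choi_simulate, choi_ofChoi,
      choi_ofChoi, swapChoi, contractResource_add, contractResource_glue, splice_maxEnt, htr]

theorem swapFeasible_bounds {K L M N : Matrix (E × G) (E × G) ℂ} (h : SwapFeasible d K L M N)
    {ρ : Matrix (E × G) (E × G) ℂ} (hρ : IsState ρ) :
    0 ≤ (ρ * K).trace.re ∧ (ρ * K).trace.re ≤ 1 := by
  obtain ⟨hK, hL, hM, hN, -, -, -, -, hsum⟩ := h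
  have h1 : ∀ X : Matrix (E × G) (E × G) ℂ, 0 ≤ X → 0 ≤ (ρ * X).trace.re := fun X hX =>
    (Complex.le_def.1 (trace_mul_nonneg hρ.1 (Matrix.nonneg_iff_posSemidef.1 hX))).1
  refine ⟨h1 K hK, ?_⟩
  have h2 := h1 _ (add_nonneg (add_nonneg hL hM) hN)
  have h3 : (ρ * K).trace + (ρ * (L + M + N)).trace = 1 := by
    rw [← Matrix.trace_add, ← Matrix.mul_add, ← add_assoc, ← add_assoc, hsum, Matrix.mul_one, hρ.2]
  have h4 := congrArg Complex.re h3
  rw [Complex.add_re, Complex.one_re] at h4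
  linarith

/-- This point makes the set of values nonempty, as the comparison of suprema requires. -/
theorem swapFeasible_one (hd : 2 ≤ d) : SwapFeasible d 0 0 0 (1 : Matrix (E × G) (E × G) ℂ) := by
  have hdr : (0 : ℝ) < d - 1 := by
    have : (2 : ℝ) ≤ d := by exact_mod_cast hd
    linarith
  have h0 : (0 : Matrix (E × G) (E × G) ℂ) ≤ 1 := zero_le_one
  have h : ∀ c : ℝ, 0 ≤ c → (0 : Matrix (E × G) (E × G) ℂ) ≤ c • 1 := fun c hc =>
    Matrix.nonneg_iff_posSemidef.2 (Matrix.PosSemidef.one.smul hc)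
  have hT : ∀ c : ℝ, transposeSnd (c • (1 : Matrix (E × G) (E × G) ℂ)) = c • 1 := fun c => by
    rw [show transposeSnd (c • (1 : Matrix (E × G) (E × G) ℂ)) = c • transposeSnd 1 from rfl,
      transposeSnd_one]
  refine ⟨le_rfl, le_rfl, le_rfl, h0, ?_, ?_, ?_, ?_, ?_⟩ <;>
    simp only [smul_zero, add_zero, zero_add, hT, map_zero, smul_smul]
  · exact h _ (by positivity)
  · exact h _ (by positivity)
  · exact h _ (by positivity)
  · exact h _ (by positivity)

theorem swap_errors_eq_reduced (hd : 2 ≤ d) {ρ : Matrix (E × G) (E × G) ℂ} (hρ : IsState ρ) :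
    errPPTInfid (swapChannel d) ρ = swapReducedSDP d ρ ∧
      errPPT (swapChannel d) ρ = swapReducedSDP d ρ ∧
      infidSDP (swapChannel d) ρ = swapReducedSDP d ρ := by
  refine swap_errors_eq (by omega) hρ ⟨_, 0, 0, 0, 1, swapFeasible_one hd, rfl⟩ ?_ ?_ ?_
  · rintro f ⟨K, L, M, N, h, rfl⟩
    exact swapFeasible_bounds h hρ
  · intro P hP
    obtain ⟨h1, h2, h3⟩ := (isCPPTP_iff P).1 hP
    exact ⟨_, _, _, _, swapFeasible_of_choi hd (Matrix.nonneg_iff_posSemidef.1 h1)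
      (Matrix.nonneg_iff_posSemidef.1 h2) h3, swapEntFid_simulate P ρ⟩
  · rintro f ⟨K, L, M, N, h, rfl⟩
    exact exists_simulate_eq_of_feasible hd h hρ

end SwapReduction

/-! ### The degenerate case d = 1. -/

section Trivial

variable {E G : Type*} [Fintype E] [Fintype G] [DecidableEq E] [DecidableEq G]

/-- A 1 × 1 matrix is determined by its trace, which channels preserve. -/
theorem eq_swapChannel_one {M : Superop (Fin 1 × Fin 1) (Fin 1 × Fin 1)} (hM : IsChannel M) :
    M = swapChannel 1 := by
  refine LinearMap.ext fun X => ?_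
  have h := (hM.2 X).trans (isChannel_swapChannel.2 X).symm
  ext p q
  rw [Matrix.trace, Matrix.trace, Fintype.sum_subsingleton _ p, Fintype.sum_subsingleton _ p] at h
  rw [Subsingleton.elim q p]
  exact h

theorem swapEntFid_swapChannel {d : ℕ} (hd : 1 ≤ d) : swapEntFid d (swapChannel d) = 1 := by
  have hd0 : (d : ℝ) ≠ 0 := by exact_mod_cast (by omega : d ≠ 0)
  have h : star (swapVec d) ⬝ᵥ choi (swapChannel d) *ᵥ swapVec d = (((d : ℝ) ^ 4 : ℝ) : ℂ) := by
    rw [choi_swapChannel, Matrix.vecMulVec_mulVec, swapVec_dotProduct_self, dotProduct_smul,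
      swapVec_dotProduct_self, op_smul_eq_mul]
    push_cast
    ring
  rw [swapEntFid, h, Complex.ofReal_re]
  exact div_self (pow_ne_zero 4 hd0)

theorem swap_errors_eq_of_dim_one {ρ : Matrix (E × G) (E × G) ℂ} (hρ : IsState ρ) :
    errPPTInfid (swapChannel 1) ρ = 1 - sSup {1} ∧ errPPT (swapChannel 1) ρ = 1 - sSup {1} ∧
      infidSDP (swapChannel 1) ρ = 1 - sSup {1} := by
  refine swap_errors_eq le_rfl hρ (Set.singleton_nonempty 1) ?_ ?_ ?_
  · rintro f rfl
    norm_num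
  · intro P hP
    rw [eq_swapChannel_one (isChannel_simulate hP.1 hρ)]
    exact swapEntFid_swapChannel le_rfl
  · rintro f rfl
    -- A simulation must be exhibited; with one-dimensional outputs, the identity Choi operator is
    -- that of the full trace.
    have hP : IsCPPTP (ofChoi
        (1 : Matrix (((Fin 1 × Fin 1) × (E × G)) × (Fin 1 × Fin 1)) _ ℂ)) := by
      have h1 : (1 : Matrix (((Fin 1 × Fin 1) × (E × G)) × (Fin 1 × Fin 1)) _ ℂ) =
          glue 1 1 := by
        ext p q
        rw [glue_apply, Matrix.one_apply, Matrix.one_apply, Matrix.one_apply]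
        simp only [Prod.ext_iff, eq_iff_true_of_subsingleton]
        simp [eq_comm]
      rw [isCPPTP_iff, choi_ofChoi]
      refine ⟨zero_le_one, ?_, ?_⟩
      · rw [h1, transposeBobChoi_glue, transposeSnd_one, ← splice_one, transposeBobOut_splice,
          transposeSnd_one, Matrix.transpose_one, splice_one, ← h1]
        exact zero_le_one
      · ext i j
        simp [traceSnd, Matrix.one_apply]
    refine ⟨_, hP, 0, ?_, ?_⟩
    · rw [isCP_iff_choi_posSemidef]
      exact Matrix.PosSemidef.zero
    · rw [eq_swapChannel_one (isChannel_simulate hP.1 hρ)]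
      simp

end Trivial

end BQT

theorem mainTheorem8 {E G : Type*} [Fintype E] [Fintype G] [DecidableEq E] [DecidableEq G]
    (d : ℕ) (hd : 1 ≤ d) (ρ : Matrix (E × G) (E × G) ℂ) (hρ : BQT.IsState ρ) :
    BQT.errPPTInfid (BQT.swapChannel d) ρ = BQT.errPPT (BQT.swapChannel d) ρ ∧
    BQT.infidSDP (BQT.swapChannel d) ρ = BQT.errPPTInfid (BQT.swapChannel d) ρ ∧
    (2 ≤ d →
      BQT.errPPTInfid (BQT.swapChannel d) ρ = BQT.swapReducedSDP d ρ ∧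
      BQT.errPPT (BQT.swapChannel d) ρ = BQT.swapReducedSDP d ρ) := by
  -- The reduced program divides by d − 1, so d = 1 is treated apart.
  rcases hd.eq_or_lt with rfl | hd2
  · obtain ⟨h1, h2, h3⟩ := BQT.swap_errors_eq_of_dim_one hρ
    exact ⟨h1.trans h2.symm, h3.trans h1.symm, fun h => absurd h (by norm_num)⟩
  · obtain ⟨h1, h2, h3⟩ := BQT.swap_errors_eq_reduced hd2 hρ
    exact ⟨h1.trans h2.symm, h3.trans h1.symm, fun _ => ⟨h1, h2⟩⟩
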